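/- **Setting.** Let $\mathbb C(\mathbb Z)$ be the space of two-sided complex sequences, $(\Delta x)_t=x_{t-1}$ the shift, $(u*v)_t=\sum_{\tau\in\mathbb Z}u_\tau v_{t-\tau}$ the convolution, $\mathbb C_n(\mathbb Z)$ the subspace of sequences vanishing for $|t|>n$, and $\|u\|_{n,2}=\big(\sum_{|t|\le n}|u_t|^2\big)^{1/2}$. Let $$(\mathcal F_n[u])_k=\frac1{\sqrt{2n+1}}\sum_{|\tau|\le n}\exp\Big(-\frac{2\pi i k\tau}{2n+1}\Big)u_\tau,\qquad k=0,\dots,2n,$$ and $\mathsf c_\star=2.16\,\pi^2+6$. Let $s\ge 1$, $m\ge s-1$ and $n=9m$ be integers. Let $X\subseteq\mathbb C(\mathbb Z)$ be a linear subspace with $\Delta X\subseteq X$ and $\dim X\le s$, and let $x\in X$. One observes $$y_t=x_t+\sigma\xi_t,\qquad |t|\le 2n,$$ where $\sigma\ge 0$ and the $\xi_t$, $|t|\le 2n$, are i.i.d. standard complex Gaussian variables, normalized so that $\operatorname{Re}\xi_t$ and $\operatorname{Im}\xi_t$ are independent $\mathcal N(0,1)$ variables. **Theorem.** For any observations, the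 problem $$\min_{\varphi\in\mathbb C_n(\mathbb Z)}\Big\{\|\varphi*y-y\|_{n,2}^2:\ \max\{\|\mathcal F_n[\varphi]\|_1,\,18s\|\mathcal F_n[\varphi]\|_\infty\}\le\frac{18\,\mathsf c_\star s}{\sqrt{2n+1}}\Big\}$$ has an optimal solution. Let $\hat\varphi=\hat\varphi(y)$ be any optimal solution. Then, for every $\delta\in(0,1)$, with probability at least $1-\delta$, $$\|\hat\varphi*y-x\|_{n,2}^2\le 80\,\mathsf c_\star^2\,\sigma^2\big(3s\log(2n+1)+10s+\log(\delta^{-1})\big)\log^2(9e^4s).$$ -/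

import Mathlib

open MeasureTheory ProbabilityTheory

/-- The delay (unit shift) operator on two-sided complex sequences. -/
def delay : (ℤ → ℂ) →ₗ[ℂ] (ℤ → ℂ) where
  toFun x := fun t => x (t - 1)
  map_add' _ _ := rfl
  map_smul' _ _ := rfl

/-- A linear subspace of two-sided sequences is shift-invariant if the delay maps it to itself. -/
def IsShiftInvariant (X : Submodule ℂ (ℤ → ℂ)) : Prop :=
  ∀ x ∈ X, delay x ∈ X

/-- Sequences supported on `{-n, ..., n}`. -/
def bandLimited (n : ℕ) : Submodule ℂ (ℤ → ℂ) where
  carrier := {x | ∀ t : ℤ, (n : ℤ) < |t| → x t = 0}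
  add_mem' hx hy t ht := by simp [hx t ht, hy t ht]
  zero_mem' _ _ := rfl
  smul_mem' c x hx t ht := by simp [hx t ht]

/-- Discrete convolution. It is used only with `u` finitely supported, when the series is a
finite sum. -/
noncomputable def conv (u v : ℤ → ℂ) : ℤ → ℂ :=
  fun t => ∑' τ : ℤ, u τ * v (t - τ)

/-- The unitary discrete Fourier transform on `{-n, ..., n}`, with frequencies `0, ..., 2n`. -/
noncomputable def dft (n : ℕ) (u : ℤ → ℂ) : Fin (2 * n + 1) → ℂ :=
  fun k => ((Real.sqrt (2 * n + 1) : ℝ) : ℂ)⁻¹ *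
    ∑ τ ∈ Finset.Icc (-(n : ℤ)) n,
      Complex.exp (-(2 * Real.pi * Complex.I * (k : ℕ) * (τ : ℂ) / (2 * n + 1))) * u τ

/-- The `ℓ₁`-norm of a finite complex vector. -/
noncomputable def l1Norm {N : ℕ} (a : Fin N → ℂ) : ℝ := ∑ k, ‖a k‖

/-- The `ℓ_∞`-norm of a finite complex vector. -/
noncomputable def linfNorm {N : ℕ} (a : Fin N → ℂ) : ℝ := ⨆ k, ‖a k‖

/-- The `ℓ₂`-seminorm of a sequence restricted to `{-n, ..., n}`. -/
noncomputable def windowNorm (n : ℕ) (u : ℤ → ℂ) : ℝ :=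
  Real.sqrt (∑ t ∈ Finset.Icc (-(n : ℤ)) n, ‖u t‖ ^ 2)

/-- The numerical constant `2.16 π² + 6`. -/
noncomputable def cStar : ℝ := 2.16 * Real.pi ^ 2 + 6

/-- The feasible filters. -/
def feasibleFilters (s n : ℕ) : Set (ℤ → ℂ) :=
  {φ | φ ∈ bandLimited n ∧
    max (l1Norm (dft n φ)) (18 * s * linfNorm (dft n φ)) ≤
      18 * cStar * s / Real.sqrt (2 * n + 1)}

/-- `φ` is an optimal solution of the residual minimization problem for the observations `y`. -/
def IsOptimalFilter (s n : ℕ) (y φ : ℤ → ℂ) : Prop :=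
  φ ∈ feasibleFilters s n ∧
    IsMinOn (fun ψ => windowNorm n (conv ψ y - y) ^ 2) (feasibleFilters s n) φ

/-- The standard complex Gaussian law: real and imaginary parts are independent `N(0, 1)`
(so the squared modulus is chi-square with two degrees of freedom). -/
noncomputable def stdComplexGaussian : Measure ℂ :=
  ((gaussianReal 0 1).prod (gaussianReal 0 1)).map Complex.measurableEquivRealProd.symm

/-! Up to the factor `√(2n+1)`, feasibility puts the values of `trigPoly n φ` on the Fourier grid in
the intersection of an ℓ∞-ball of radius `cStar` and an ℓ₁-ball of radius `cStar * 18s`.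

Some feasible filter φ₀ reproduces X exactly (`exists_reproducing_filter`): restrict X to m+1
consecutive points, take the kernel of the orthogonal projection onto the restricted space, and
average it along its diagonals. Shift-invariance gives reproduction, and the transform at θ is the
normalized energy of the projected exponential, so it lies in [0,1].

The residual of φ₀ is pure noise, φ₀*σξ − σξ. Since φhat has a residual no larger, expanding both
squares bounds ‖φhat*y − x‖² by twice the pairing of the noise with φhat*y − x, plus terms in φ₀ and
the noise (`GoodNoise.error_le`). As φhat depends on the noise, every bound must be uniform in the
filter. The signal part φhat*x − x stays in the fixed space X, hence costs only the projection of
the noise on X. The noise part is linear in the filter, and a linear functional on the two-ball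
intersection is dominated by its values at sign vectors with at most S = 18s nonzero entries
(`exists_signType_sum_mul_le`, applied to real and imaginary parts). A union bound over at most
(3(2n+1))^S patterns produces the term s log(2n+1).

For one sign pattern, decay of the Dirichlet kernel bounds the transform at all frequencies by 4 + 2
log S (`norm_trigPoly_synth_le`). This is an operator norm bound for the convolution, the source of
the squared logarithm, and it feeds a Chernoff bound for Gaussian quadratic forms
(`pi_gaussianReal_tail`). -/

/-! ### Fourier analysis on a finite window -/

/-- The trigonometric polynomial whose coefficients are the values of `u` on `{-n, ..., n}`. -/
noncomputable def trigPoly (n : ℕ) (u : ℤ → ℂ) (θ : ℝ) : ℂ :=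
  ∑ τ ∈ Finset.Icc (-(n : ℤ)) n, Complex.exp (-(θ * τ * Complex.I)) * u τ

/-- The frequencies of the discrete Fourier transform of length `2 * n + 1`. -/
noncomputable def dftFreq (n k : ℕ) : ℝ := 2 * Real.pi * k / (2 * n + 1)

lemma dft_eq_trigPoly (n : ℕ) (u : ℤ → ℂ) (k : Fin (2 * n + 1)) :
    dft n u k = ((Real.sqrt (2 * n + 1) : ℝ) : ℂ)⁻¹ * trigPoly n u (dftFreq n k) := by
  simp only [dft, trigPoly, dftFreq]
  congr 1
  refine Finset.sum_congr rfl fun τ _ => ?_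
  congr 2
  push_cast
  ring

lemma sum_exp_dftFreq (n : ℕ) (a : ℤ) :
    ∑ k : Fin (2 * n + 1), Complex.exp (dftFreq n k * a * Complex.I) =
      if ((2 * n + 1 : ℕ) : ℤ) ∣ a then (2 * n + 1 : ℂ) else 0 := by
  have hN : ((2 * n + 1 : ℕ) : ℂ) ≠ 0 := Nat.cast_ne_zero.2 (Nat.succ_ne_zero _)
  have hN' : (2 * n + 1 : ℂ) ≠ 0 := by exact_mod_cast hN
  set z : ℂ := Complex.exp (2 * Real.pi * Complex.I * (a / (2 * n + 1 : ℂ))) with hz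
  have h1 : ∀ k : ℕ, Complex.exp (dftFreq n k * a * Complex.I) = z ^ k := by
    intro k
    rw [hz, ← Complex.exp_nat_mul]
    congr 1
    simp only [dftFreq]
    push_cast
    field_simp
  have h2 : z ^ (2 * n + 1) = 1 := by
    rw [hz, ← Complex.exp_nat_mul, Complex.exp_eq_one_iff]
    refine ⟨a, ?_⟩
    push_cast
    field_simp
  simp_rw [h1]
  rw [Fin.sum_univ_eq_sum_range (fun k => z ^ k)]
  have h3 : z = 1 ↔ ((2 * n + 1 : ℕ) : ℤ) ∣ a := by
    rw [hz, Complex.exp_eq_one_iff]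
    constructor
    · rintro ⟨j, hj⟩
      refine ⟨j, ?_⟩
      have hp := Complex.two_pi_I_ne_zero
      have : (a : ℂ) = (2 * n + 1) * j := by
        rw [mul_comm (j : ℂ)] at hj
        have := mul_left_cancel₀ hp hj
        field_simp at this
        rw [this]
      exact_mod_cast this
    · rintro ⟨j, rfl⟩
      refine ⟨j, ?_⟩
      push_cast
      field_simp
  split_ifs with h
  · rw [h3.2 h]; simp
  · have h4 : z - 1 ≠ 0 := fun h5 => h (h3.1 (sub_eq_zero.1 h5))
    have := mul_geom_sum z (2 * n + 1)
    rw [h2, sub_self] at this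
    exact (mul_eq_zero.1 this).resolve_left h4

lemma sum_exp_dftFreq_sub (n : ℕ) {s t : ℤ} (hs : s ∈ Finset.Icc (-(n : ℤ)) n)
    (ht : t ∈ Finset.Icc (-(n : ℤ)) n) :
    ∑ k : Fin (2 * n + 1), Complex.exp (dftFreq n k * (s - t : ℤ) * Complex.I) =
      if s = t then (2 * n + 1 : ℂ) else 0 := by
  rw [sum_exp_dftFreq]
  rw [Finset.mem_Icc] at hs ht
  refine if_congr ?_ rfl rfl
  constructor
  · intro h
    have := Int.eq_zero_of_abs_lt_dvd h (by rw [abs_lt]; push_cast; omega)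
    omega
  · rintro rfl; simp

lemma trigPoly_inversion (n : ℕ) (u : ℤ → ℂ) {t : ℤ} (ht : t ∈ Finset.Icc (-(n : ℤ)) n) :
    ∑ k : Fin (2 * n + 1), Complex.exp (dftFreq n k * t * Complex.I) *
      trigPoly n u (dftFreq n k) = (2 * n + 1) * u t := by
  simp only [trigPoly, Finset.mul_sum]
  rw [Finset.sum_comm]
  have : ∀ τ ∈ Finset.Icc (-(n : ℤ)) n, ∑ k : Fin (2 * n + 1),
      Complex.exp (dftFreq n k * t * Complex.I) *
        (Complex.exp (-(dftFreq n k * τ * Complex.I)) * u τ) =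
      if t = τ then (2 * n + 1) * u τ else 0 := by
    intro τ hτ
    have := sum_exp_dftFreq_sub n ht hτ
    simp_rw [← mul_assoc, ← Finset.sum_mul, ← Complex.exp_add]
    rw [← ite_zero_mul, ← this]
    congr 1
    refine Finset.sum_congr rfl fun k _ => ?_
    congr 1
    push_cast
    ring
  rw [Finset.sum_congr rfl this, Finset.sum_ite_eq, if_pos ht]

lemma conj_trigPoly (n : ℕ) (u : ℤ → ℂ) (θ : ℝ) :
    (starRingEnd ℂ) (trigPoly n u θ) = ∑ τ ∈ Finset.Icc (-(n : ℤ)) n,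
      Complex.exp (θ * τ * Complex.I) * (starRingEnd ℂ) (u τ) := by
  simp [trigPoly, map_sum, ← Complex.exp_conj]

lemma sum_norm_sq_trigPoly (n : ℕ) (u : ℤ → ℂ) :
    ∑ k : Fin (2 * n + 1), ‖trigPoly n u (dftFreq n k)‖ ^ 2 =
      (2 * n + 1) * ∑ t ∈ Finset.Icc (-(n : ℤ)) n, ‖u t‖ ^ 2 := by
  have h : ∀ z : ℂ, ((‖z‖ ^ 2 : ℝ) : ℂ) = (starRingEnd ℂ) z * z := fun z => by
    rw [mul_comm, Complex.mul_conj, Complex.normSq_eq_norm_sq]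
  have key : ((∑ k : Fin (2 * n + 1), ‖trigPoly n u (dftFreq n k)‖ ^ 2 : ℝ) : ℂ) =
      (((2 * n + 1) * ∑ t ∈ Finset.Icc (-(n : ℤ)) n, ‖u t‖ ^ 2 : ℝ) : ℂ) := by
    push_cast
    simp_rw [← Complex.ofReal_pow, h, conj_trigPoly, Finset.sum_mul]
    rw [Finset.sum_comm, Finset.mul_sum]
    refine Finset.sum_congr rfl fun t ht => ?_
    have := trigPoly_inversion n u ht
    calc _ = (starRingEnd ℂ) (u t) * ∑ k : Fin (2 * n + 1),
          Complex.exp (dftFreq n k * t * Complex.I) * trigPoly n u (dftFreq n k) := by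
          rw [Finset.mul_sum]
          exact Finset.sum_congr rfl fun k _ => by ring
      _ = _ := by rw [this]; ring
  exact_mod_cast key

lemma conv_eq_sum {n : ℕ} {φ : ℤ → ℂ} (hφ : φ ∈ bandLimited n) (v : ℤ → ℂ) (t : ℤ) :
    conv φ v t = ∑ τ ∈ Finset.Icc (-(n : ℤ)) n, φ τ * v (t - τ) := by
  refine tsum_eq_sum fun τ hτ => ?_
  rw [hφ τ, zero_mul]
  rw [Finset.mem_Icc, ← abs_le] at hτ
  exact not_le.1 hτ

lemma trigPoly_eq_tsum {n : ℕ} {u : ℤ → ℂ} (hu : u ∈ bandLimited n) (θ : ℝ) :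
    trigPoly n u θ = ∑' t : ℤ, Complex.exp (-(θ * t * Complex.I)) * u t := by
  refine (tsum_eq_sum fun τ hτ => ?_).symm
  rw [hu τ, mul_zero]
  rw [Finset.mem_Icc, ← abs_le] at hτ
  exact not_le.1 hτ

lemma bandLimited_mono {n p : ℕ} (h : n ≤ p) : bandLimited n ≤ bandLimited p :=
  fun _ hu t ht => hu t (lt_of_le_of_lt (by exact_mod_cast h) ht)

/-- Supports add up under convolution, so the window of radius n + p loses no term and the product
formula is exact, without wrap-around. -/
lemma trigPoly_conv {n p : ℕ} {φ u : ℤ → ℂ} (hφ : φ ∈ bandLimited n)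
    (hu : u ∈ bandLimited p) (θ : ℝ) :
    trigPoly (n + p) (conv φ u) θ = trigPoly n φ θ * trigPoly p u θ := by
  rw [trigPoly]
  simp_rw [conv_eq_sum hφ, Finset.mul_sum]
  rw [Finset.sum_comm, trigPoly, Finset.sum_mul]
  refine Finset.sum_congr rfl fun τ hτ => ?_
  rw [trigPoly_eq_tsum hu, ← (Equiv.subRight τ).tsum_eq, ← tsum_mul_left]
  rw [tsum_eq_sum (s := Finset.Icc (-((n + p : ℕ) : ℤ)) (n + p : ℕ))]
  · refine Finset.sum_congr rfl fun t _ => ?_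
    have : Complex.exp (-(θ * t * Complex.I)) = Complex.exp (-(θ * τ * Complex.I)) *
        Complex.exp (-(θ * (t - τ : ℤ) * Complex.I)) := by
      rw [← Complex.exp_add]; congr 1; push_cast; ring
    rw [this, Equiv.subRight_apply]
    ring
  · intro t ht
    rw [Equiv.subRight_apply, hu, mul_zero, mul_zero]
    rw [Finset.mem_Icc, ← abs_le] at hτ ht
    push_cast at ht
    have := abs_sub_abs_le_abs_sub t τ
    linarith

lemma windowNorm_sq (n : ℕ) (u : ℤ → ℂ) :
    windowNorm n u ^ 2 = ∑ t ∈ Finset.Icc (-(n : ℤ)) n, ‖u t‖ ^ 2 :=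
  Real.sq_sqrt (Finset.sum_nonneg fun _ _ => sq_nonneg _)

/-- Convolution with a filter whose transform is bounded by `L` has norm at most `L`. -/
lemma sum_norm_sq_conv_le {n p q : ℕ} {φ u : ℤ → ℂ} (hφ : φ ∈ bandLimited n)
    (hu : u ∈ bandLimited p) (hq : q ≤ n + p) {L : ℝ} (hL : ∀ θ, ‖trigPoly n φ θ‖ ≤ L) :
    ∑ t ∈ Finset.Icc (-(q : ℤ)) q, ‖conv φ u t‖ ^ 2 ≤
      L ^ 2 * ∑ t ∈ Finset.Icc (-(p : ℤ)) p, ‖u t‖ ^ 2 := by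
  have hL0 : 0 ≤ L := (norm_nonneg _).trans (hL 0)
  have hN : (0 : ℝ) < 2 * (n + p : ℕ) + 1 := by positivity
  have h1 : ∑ t ∈ Finset.Icc (-(q : ℤ)) q, ‖conv φ u t‖ ^ 2 ≤
      ∑ t ∈ Finset.Icc (-((n + p : ℕ) : ℤ)) (n + p : ℕ), ‖conv φ u t‖ ^ 2 := by
    refine Finset.sum_le_sum_of_subset_of_nonneg (Finset.Icc_subset_Icc ?_ ?_)
      fun _ _ _ => sq_nonneg _ <;> push_cast <;> omega
  have h2 : ∑ t ∈ Finset.Icc (-((n + p : ℕ) : ℤ)) (n + p : ℕ), ‖u t‖ ^ 2 =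
      ∑ t ∈ Finset.Icc (-(p : ℤ)) p, ‖u t‖ ^ 2 := by
    refine (Finset.sum_subset (Finset.Icc_subset_Icc ?_ ?_) fun t _ ht => ?_).symm
    · push_cast; omega
    · push_cast; omega
    · rw [hu]
      · simp
      · rw [Finset.mem_Icc, ← abs_le] at ht
        exact not_le.1 ht
  refine h1.trans ?_
  rw [← h2]
  -- Parseval on the larger window turns both sides into sums over a grid of 2(n+p)+1 frequencies.
  -- These are in general not on the grid of length 2n+1, which is why the bound on the transform is
  -- required at every θ.
  refine le_of_mul_le_mul_left ?_ hN
  rw [← sum_norm_sq_trigPoly, mul_left_comm, ← sum_norm_sq_trigPoly, Finset.mul_sum]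
  refine Finset.sum_le_sum fun k _ => ?_
  have h3 : trigPoly (n + p) u (dftFreq (n + p) k) = trigPoly p u (dftFreq (n + p) k) := by
    rw [trigPoly_eq_tsum hu, trigPoly_eq_tsum (bandLimited_mono (Nat.le_add_left p n) hu)]
  rw [trigPoly_conv hφ hu, h3, norm_mul, mul_pow]
  gcongr
  exact hL _

/-! ### The Dirichlet kernel -/

/-- The normalized Dirichlet kernel of degree `n`. -/
noncomputable def dirichletKer (n : ℕ) (x : ℝ) : ℂ :=
  (2 * n + 1 : ℂ)⁻¹ * ∑ τ ∈ Finset.Icc (-(n : ℤ)) n, Complex.exp (x * τ * Complex.I)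

lemma sub_one_mul_sum_exp (n : ℕ) (x : ℝ) :
    (Complex.exp (Complex.I * x) - 1) * ∑ τ ∈ Finset.Icc (-(n : ℤ)) n,
      Complex.exp (x * τ * Complex.I) =
      Complex.exp ((x * (n + 1) : ℝ) * Complex.I) - Complex.exp ((-(x * n) : ℝ) * Complex.I) := by
  induction n with
  | zero => simp [mul_comm]
  | succ n ih =>
    have h : Finset.Icc (-((n + 1 : ℕ) : ℤ)) (n + 1 : ℕ) =
        insert (-((n : ℤ) + 1)) (insert ((n : ℤ) + 1) (Finset.Icc (-(n : ℤ)) n)) := by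
      ext t
      simp only [Finset.mem_Icc, Finset.mem_insert]
      push_cast
      omega
    rw [h, Finset.sum_insert, Finset.sum_insert, mul_add, mul_add, ih]
    · simp only [sub_mul, ← Complex.exp_add, one_mul]
      push_cast
      ring_nf
    · simp
    · simp only [Finset.mem_Icc, Finset.mem_insert]; omega

lemma norm_two_mul_add_one (n : ℕ) : ‖(2 * n + 1 : ℂ)‖ = 2 * n + 1 := by
  exact_mod_cast Complex.norm_natCast (2 * n + 1)

lemma norm_dirichletKer_le_one (n : ℕ) (x : ℝ) : ‖dirichletKer n x‖ ≤ 1 := by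
  have hN : (0 : ℝ) < 2 * n + 1 := by positivity
  have h0 := norm_two_mul_add_one n
  rw [dirichletKer, norm_mul, norm_inv, h0, inv_mul_le_iff₀ hN, mul_one]
  refine (norm_sum_le _ _).trans ?_
  have : ∀ τ ∈ Finset.Icc (-(n : ℤ)) n, ‖Complex.exp (x * τ * Complex.I)‖ = 1 := fun τ _ => by
    have := Complex.norm_exp_ofReal_mul_I (x * τ)
    push_cast at this
    exact this
  rw [Finset.sum_congr rfl this, Finset.sum_const, Int.card_Icc, nsmul_eq_mul, mul_one]
  have : ((n : ℤ) + 1 - -(n : ℤ)).toNat = 2 * n + 1 := by omega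
  rw [this]; push_cast; rfl

/-- The geometric sum has numerator of modulus at most 2, and Jordan's inequality gives |e^{ix} − 1|
≥ 2|x|/π on [−π, π]. -/
lemma norm_dirichletKer_le (n : ℕ) {x : ℝ} (hx : |x| ≤ Real.pi) (h0 : x ≠ 0) :
    ‖dirichletKer n x‖ ≤ Real.pi / ((2 * n + 1) * |x|) := by
  have hN : (0 : ℝ) < 2 * n + 1 := by positivity
  have h1 := norm_two_mul_add_one n
  have hx0 : 0 < |x| := abs_pos.2 h0
  have h2 : 2 / Real.pi * |x| ≤ ‖Complex.exp (Complex.I * x) - 1‖ := by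
    rw [Complex.norm_exp_I_mul_ofReal_sub_one, Real.norm_eq_abs, abs_mul, abs_two]
    have := Real.mul_abs_le_abs_sin (x := x / 2) (by rw [abs_div, abs_two]; linarith)
    rw [abs_div, abs_two] at this
    linarith
  have h3 := congrArg norm (sub_one_mul_sum_exp n x)
  rw [norm_mul] at h3
  have h4 := norm_sub_le (Complex.exp ((x * (n + 1) : ℝ) * Complex.I))
    (Complex.exp ((-(x * n) : ℝ) * Complex.I))
  rw [Complex.norm_exp_ofReal_mul_I, Complex.norm_exp_ofReal_mul_I, ← h3] at h4
  have hpi := Real.pi_pos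
  rw [dirichletKer, norm_mul, norm_inv, h1, inv_mul_le_iff₀ hN]
  have h5 := (mul_le_mul_of_nonneg_right h2 (norm_nonneg (∑ τ ∈ Finset.Icc (-(n : ℤ)) n,
      Complex.exp (x * τ * Complex.I)))).trans h4
  have h6 : (2 * (n : ℝ) + 1) * (Real.pi / ((2 * n + 1) * |x|)) = Real.pi / |x| := by
    field_simp
  rw [h6, le_div_iff₀ hx0]
  have h7 : 2 / Real.pi * |x| * ‖∑ τ ∈ Finset.Icc (-(n : ℤ)) n,
      Complex.exp (x * τ * Complex.I)‖ = 2 / Real.pi * (‖∑ τ ∈ Finset.Icc (-(n : ℤ)) n,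
      Complex.exp (x * τ * Complex.I)‖ * |x|) := by ring
  rw [h7, div_mul_eq_mul_div, div_le_iff₀ hpi] at h5
  linarith

lemma dirichletKer_add_int_mul_two_pi (n : ℕ) (x : ℝ) (q : ℤ) :
    dirichletKer n (x + q * (2 * Real.pi)) = dirichletKer n x := by
  simp only [dirichletKer]
  congr 1
  refine Finset.sum_congr rfl fun τ _ => ?_
  rw [Complex.exp_eq_exp_iff_exists_int]
  exact ⟨q * τ, by push_cast; ring⟩

/-- Elements outside [−S, S] contribute at most 1/S each, hence at most 1 together. The interval
itself contributes 1 plus twice the harmonic number of S. -/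
lemma sum_inv_abs_le {S : ℕ} (hS : 1 ≤ S) (A : Finset ℤ) (hA : A.card ≤ S) :
    ∑ r ∈ A, (if r = 0 then 1 else |(r : ℝ)|⁻¹) ≤ 4 + 2 * Real.log S := by
  have hS' : (0 : ℝ) < S := by exact_mod_cast hS
  set g : ℤ → ℝ := fun r => if r = 0 then 1 else |(r : ℝ)|⁻¹ with hg
  have hg0 : ∀ r, 0 ≤ g r := fun r => by simp only [hg]; split_ifs <;> positivity
  have h1 : ∀ r ∈ A, g r ≤ (S : ℝ)⁻¹ + if r ∈ Finset.Icc (-(S : ℤ)) S then g r else 0 := by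
    intro r _
    split_ifs with h
    · have : (0 : ℝ) ≤ (S : ℝ)⁻¹ := by positivity
      linarith
    · rw [Finset.mem_Icc, ← abs_le, not_le] at h
      have hr : r ≠ 0 := by rintro rfl; simp at h; omega
      simp only [hg, if_neg hr, add_zero]
      refine inv_anti₀ hS' ?_
      have : ((S : ℤ) : ℝ) ≤ ((|r| : ℤ) : ℝ) := by exact_mod_cast h.le
      simpa using this
  have h2 : ∑ r ∈ Finset.Icc (-(S : ℤ)) S, g r ≤ 3 + 2 * Real.log S := by
    have heven : Function.Even g := fun r => by simp [hg]
    rw [Finset.sum_Icc_of_even_eq_range heven, Finset.sum_range_succ']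
    have h3 : ∑ k ∈ Finset.range S, g ((k + 1 : ℕ) : ℤ) = ((harmonic S : ℚ) : ℝ) := by
      rw [harmonic]
      push_cast
      refine Finset.sum_congr rfl fun k _ => ?_
      have : ((k : ℤ) + 1) ≠ 0 := by omega
      simp only [hg, if_neg this]
      push_cast
      rw [abs_of_nonneg (by positivity)]
    rw [h3]
    have h4 := harmonic_le_one_add_log S
    have h5 : g 0 = 1 := by simp [hg]
    simp only [Nat.cast_zero, h5, nsmul_eq_mul]
    push_cast
    linarith
  calc ∑ r ∈ A, g r ≤ ∑ r ∈ A, ((S : ℝ)⁻¹ + if r ∈ Finset.Icc (-(S : ℤ)) S then g r else 0) :=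
        Finset.sum_le_sum h1
    _ = A.card * (S : ℝ)⁻¹ + ∑ r ∈ A with r ∈ Finset.Icc (-(S : ℤ)) S, g r := by
        rw [Finset.sum_add_distrib, Finset.sum_const, nsmul_eq_mul, Finset.sum_filter]
    _ ≤ 1 + ∑ r ∈ Finset.Icc (-(S : ℤ)) S, g r := by
        refine add_le_add ?_ (Finset.sum_le_sum_of_subset_of_nonneg
          (fun r hr => (Finset.mem_filter.1 hr).2) fun r _ _ => hg0 r)
        rw [← div_eq_mul_inv, div_le_one hS']
        exact_mod_cast hA
    _ ≤ _ := by linarith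

/-- The residue of `k - round x` of least absolute value modulo `2 * n + 1`. -/
noncomputable def nearestResidue (n : ℕ) (x : ℝ) (k : ℕ) : ℤ := Int.bmod (k - round x) (2 * n + 1)

lemma nearestResidue_injective (n : ℕ) (x : ℝ) :
    Function.Injective fun k : Fin (2 * n + 1) => nearestResidue n x k := by
  intro k l h
  simp only [nearestResidue] at h
  have h1 := Int.dvd_self_sub_bmod (x := (k : ℤ) - round x) (m := 2 * n + 1)
  have h2 := Int.dvd_self_sub_bmod (x := (l : ℤ) - round x) (m := 2 * n + 1)
  rw [h] at h1
  have h3 := dvd_sub h1 h2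
  have h4 := Int.eq_zero_of_abs_lt_dvd h3 (by
    have := k.2; have := l.2; rw [abs_lt]; constructor <;> push_cast <;> omega)
  ext
  omega

/-- Modulo 2π the argument is 2π(r − f)/(2n+1), where |f| ≤ 1/2 is the rounding error. Since |r| ≤ n
it lies in [−π, π], and since |r| ≥ 1 one has |r − f| ≥ |r|/2, which cancels the factor 2 in the
decay bound. -/
lemma norm_dirichletKer_dftFreq_le (n k : ℕ) (θ : ℝ) :
    let r := nearestResidue n (θ * (2 * n + 1) / (2 * Real.pi)) k
    ‖dirichletKer n (dftFreq n k - θ)‖ ≤ if r = 0 then 1 else |(r : ℝ)|⁻¹ := by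
  intro r
  split_ifs with hr
  · exact norm_dirichletKer_le_one _ _
  set x := θ * (2 * n + 1) / (2 * Real.pi) with hx
  have hpi := Real.pi_pos
  have hN : (0 : ℝ) < 2 * n + 1 := by positivity
  obtain ⟨q, hq⟩ := Int.dvd_self_sub_bmod (x := (k : ℤ) - round x) (m := 2 * n + 1)
  have hq' : (k : ℤ) - round x - r = (2 * n + 1 : ℕ) * q := hq
  have hqR : (k : ℝ) - round x - r = (2 * n + 1) * q := by exact_mod_cast hq'
  have hf := abs_sub_round x
  set f := x - round x with hfdef
  have hθ : θ = 2 * Real.pi * x / (2 * n + 1) := by rw [hx]; field_simp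
  have h1 : dftFreq n k - θ = 2 * Real.pi * (r - f) / (2 * n + 1) + q * (2 * Real.pi) := by
    have : (k : ℝ) - x = (r - f) + (2 * n + 1) * q := by rw [hfdef, ← hqR]; ring
    have h2 : dftFreq n k - θ = 2 * Real.pi * (k - x) / (2 * n + 1) := by
      rw [dftFreq]; nth_rewrite 1 [hθ]; ring
    rw [h2, this]
    field_simp
  rw [h1, dirichletKer_add_int_mul_two_pi]
  have hr1 : (1 : ℝ) ≤ |(r : ℝ)| := by exact_mod_cast Int.one_le_abs hr
  have hrn : |(r : ℝ)| ≤ n := by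
    have a := Int.le_bmod (x := (k : ℤ) - round x) (m := 2 * n + 1) (by omega)
    have b := Int.bmod_lt (x := (k : ℤ) - round x) (m := 2 * n + 1) (by omega)
    have : |r| ≤ n := by
      rw [abs_le]
      have hrb : r = Int.bmod ((k : ℤ) - round x) (2 * n + 1) := rfl
      rw [← hrb] at a b
      push_cast at a b
      omega
    exact_mod_cast this
  have hup : |(r : ℝ) - f| ≤ n + 1 / 2 := (abs_sub _ _).trans (add_le_add hrn hf)
  have hlo : |(r : ℝ)| / 2 ≤ |(r : ℝ) - f| := by
    have := abs_sub_abs_le_abs_sub (r : ℝ) f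
    linarith
  have hpos : 0 < |(r : ℝ) - f| := by linarith
  have habs : |2 * Real.pi * (r - f) / (2 * n + 1)| = 2 * Real.pi * |(r : ℝ) - f| / (2 * n + 1) := by
    rw [abs_div, abs_mul, abs_of_pos (by positivity : 0 < 2 * Real.pi), abs_of_pos hN]
  refine (norm_dirichletKer_le n ?_ ?_).trans ?_
  · rw [habs, div_le_iff₀ hN]
    nlinarith
  · rw [← abs_pos, habs]; positivity
  · rw [habs]
    have : Real.pi / ((2 * n + 1) * (2 * Real.pi * |(r : ℝ) - f| / (2 * n + 1))) =
        (2 * |(r : ℝ) - f|)⁻¹ := by field_simp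
    rw [this]
    exact inv_anti₀ (by linarith) (by linarith)

/-! ### Filters synthesized from their spectrum -/

/-- The filter on `{-n, ..., n}` with prescribed values `a` of its Fourier transform. -/
noncomputable def synth (n : ℕ) (a : Fin (2 * n + 1) → ℂ) : ℤ → ℂ := fun τ =>
  if |τ| ≤ n then (2 * n + 1 : ℂ)⁻¹ *
    ∑ k : Fin (2 * n + 1), Complex.exp (dftFreq n k * τ * Complex.I) * a k else 0

lemma synth_mem (n : ℕ) (a : Fin (2 * n + 1) → ℂ) : synth n a ∈ bandLimited n :=
  fun t ht => by rw [synth, if_neg (not_le.2 ht)]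

lemma synth_trigPoly {n : ℕ} {φ : ℤ → ℂ} (hφ : φ ∈ bandLimited n) :
    synth n (fun k => trigPoly n φ (dftFreq n k)) = φ := by
  ext τ
  rw [synth]
  split_ifs with h
  · have hN : (2 * n + 1 : ℂ) ≠ 0 := by exact_mod_cast Nat.succ_ne_zero (2 * n)
    rw [trigPoly_inversion n φ (Finset.mem_Icc.2 (abs_le.1 h)), inv_mul_cancel_left₀ hN]
  · exact (hφ τ (not_le.1 h)).symm

lemma trigPoly_synth (n : ℕ) (a : Fin (2 * n + 1) → ℂ) (θ : ℝ) :
    trigPoly n (synth n a) θ = ∑ k, a k * dirichletKer n (dftFreq n k - θ) := by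
  simp only [trigPoly, dirichletKer, Finset.mul_sum]
  rw [Finset.sum_comm]
  refine Finset.sum_congr rfl fun τ hτ => ?_
  rw [synth, if_pos (abs_le.2 (Finset.mem_Icc.1 hτ)), Finset.mul_sum, Finset.mul_sum]
  refine Finset.sum_congr rfl fun k _ => ?_
  have : Complex.exp ((dftFreq n k - θ : ℝ) * τ * Complex.I) =
      Complex.exp (-(θ * τ * Complex.I)) * Complex.exp (dftFreq n k * τ * Complex.I) := by
    rw [← Complex.exp_add]; congr 1; push_cast; ring
  rw [this]; ring

/-- Between grid points the transform is a combination of translated Dirichlet kernels. Distinct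
grid points have distinct residues relative to θ, so at most S nonzero entries cost at most the sum
of 1/|r| over S distinct integers. -/
lemma norm_trigPoly_synth_le {n S : ℕ} (hS : 1 ≤ S) {a : Fin (2 * n + 1) → ℂ}
    (ha : ∀ k, ‖a k‖ ≤ 1) (hcard : (Finset.univ.filter fun k => a k ≠ 0).card ≤ S) (θ : ℝ) :
    ‖trigPoly n (synth n a) θ‖ ≤ 4 + 2 * Real.log S := by
  set A := Finset.univ.filter fun k => a k ≠ 0
  set r : Fin (2 * n + 1) → ℤ := fun k => nearestResidue n (θ * (2 * n + 1) / (2 * Real.pi)) k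
  rw [trigPoly_synth, ← Finset.sum_filter_of_ne (p := fun k => a k ≠ 0)
    (fun k _ h => left_ne_zero_of_mul h)]
  calc ‖∑ k ∈ A, a k * dirichletKer n (dftFreq n k - θ)‖
      ≤ ∑ k ∈ A, ‖a k * dirichletKer n (dftFreq n k - θ)‖ := norm_sum_le _ _
    _ ≤ ∑ k ∈ A, (if r k = 0 then 1 else |(r k : ℝ)|⁻¹) := by
        refine Finset.sum_le_sum fun k _ => ?_
        rw [norm_mul]
        exact (mul_le_of_le_one_left (norm_nonneg _) (ha k)).trans
          (norm_dirichletKer_dftFreq_le n k θ)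
    _ = ∑ q ∈ A.image r, (if q = 0 then 1 else |(q : ℝ)|⁻¹) :=
        (Finset.sum_image (f := fun q : ℤ => if q = 0 then 1 else |(q : ℝ)|⁻¹)
          ((nearestResidue_injective n _).injOn)).symm
    _ ≤ _ := sum_inv_abs_le hS _ (Finset.card_image_le.trans hcard)

/-- On the grid the kernel is the cardinal function, so synthesis really interpolates the prescribed
values. -/
lemma dirichletKer_dftFreq_sub (n : ℕ) (k l : Fin (2 * n + 1)) :
    dirichletKer n (dftFreq n k - dftFreq n l) = if k = l then 1 else 0 := by
  have hN : (0 : ℝ) < 2 * n + 1 := by positivity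
  have hNC : (2 * n + 1 : ℂ) ≠ 0 := by exact_mod_cast Nat.succ_ne_zero (2 * n)
  split_ifs with h
  · subst h
    simp only [sub_self, dirichletKer, Complex.ofReal_zero, zero_mul, Complex.exp_zero,
      Finset.sum_const, Int.card_Icc, nsmul_eq_mul, mul_one]
    have : ((n : ℤ) + 1 - -(n : ℤ)).toNat = 2 * n + 1 := by omega
    rw [this]
    push_cast
    exact inv_mul_cancel₀ hNC
  · set x := dftFreq n k - dftFreq n l with hx
    have hxe : x = 2 * Real.pi * ((k : ℝ) - l) / (2 * n + 1) := by
      rw [hx, dftFreq, dftFreq]; ring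
    have h1 := sub_one_mul_sum_exp n x
    have h2 : Complex.exp ((x * (n + 1) : ℝ) * Complex.I) =
        Complex.exp ((-(x * n) : ℝ) * Complex.I) := by
      rw [Complex.exp_eq_exp_iff_exists_int]
      refine ⟨(k : ℤ) - l, ?_⟩
      rw [hxe]
      push_cast
      field_simp
      ring
    have h3 : Complex.exp (Complex.I * x) - 1 ≠ 0 := by
      intro h4
      rw [sub_eq_zero, Complex.exp_eq_one_iff] at h4
      obtain ⟨j, hj⟩ := h4
      have h5 : (x : ℂ) = (j * (2 * Real.pi) : ℝ) := by
        have := Complex.I_ne_zero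
        apply mul_left_cancel₀ this
        rw [hj]; push_cast; ring
      have h6 : x = j * (2 * Real.pi) := by exact_mod_cast h5
      rw [hxe, div_eq_iff hN.ne'] at h6
      have h7 : (k : ℝ) - l = j * (2 * n + 1) := by
        have := Real.pi_pos
        have h8 : 2 * Real.pi * ((k : ℝ) - l) = 2 * Real.pi * (j * (2 * n + 1)) := by
          rw [h6]; ring
        exact mul_left_cancel₀ (by positivity) h8
      have h8 : ((k : ℕ) : ℤ) - (l : ℕ) = (2 * n + 1 : ℕ) * j := by
        have : (((k : ℕ) : ℤ) - (l : ℕ) : ℝ) = ((2 * n + 1 : ℕ) * j : ℝ) := by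
          push_cast; rw [h7]; ring
        exact_mod_cast this
      have h9 := Int.eq_zero_of_abs_lt_dvd (Dvd.intro _ h8.symm) (by
        have := k.2; have := l.2; rw [abs_lt]; constructor <;> push_cast <;> omega)
      exact h (by ext; omega)
    rw [h2, sub_self] at h1
    rw [dirichletKer, (mul_eq_zero.1 h1).resolve_left h3, mul_zero]

lemma trigPoly_synth_dftFreq (n : ℕ) (a : Fin (2 * n + 1) → ℂ) (l : Fin (2 * n + 1)) :
    trigPoly n (synth n a) (dftFreq n l) = a l := by
  rw [trigPoly_synth]
  simp [dirichletKer_dftFreq_sub]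

lemma sum_norm_sq_synth (n : ℕ) (a : Fin (2 * n + 1) → ℂ) :
    (2 * n + 1) * ∑ t ∈ Finset.Icc (-(n : ℤ)) n, ‖synth n a t‖ ^ 2 = ∑ k, ‖a k‖ ^ 2 := by
  rw [← sum_norm_sq_trigPoly]
  simp [trigPoly_synth_dftFreq]

lemma synth_zero_index (n : ℕ) (a : Fin (2 * n + 1) → ℂ) :
    synth n a 0 = (2 * n + 1 : ℂ)⁻¹ * ∑ k, a k := by
  simp [synth]

/-! ### Reduction to sparse sign patterns -/

lemma exists_card_eq_forall_le {ι : Type*} [Fintype ι] [DecidableEq ι] (v : ι → ℝ) {S : ℕ}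
    (hS : S ≤ Fintype.card ι) : ∃ A : Finset ι, A.card = S ∧ ∀ i ∈ A, ∀ j ∉ A, v j ≤ v i := by
  induction S with
  | zero => exact ⟨∅, rfl, by simp⟩
  | succ S ih =>
    obtain ⟨A, hA, h⟩ := ih (by omega)
    have hne : (Aᶜ).Nonempty := by
      rw [← Finset.card_pos, Finset.card_compl]; omega
    obtain ⟨i₀, hi₀, hmax⟩ := Finset.exists_max_image Aᶜ v hne
    rw [Finset.mem_compl] at hi₀
    refine ⟨insert i₀ A, by rw [Finset.card_insert_of_notMem hi₀, hA], fun i hi j hj => ?_⟩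
    rw [Finset.mem_insert, not_or] at hj
    rcases Finset.mem_insert.1 hi with rfl | hi
    · exact hmax j (Finset.mem_compl.2 hj.2)
    · exact h i hi j hj.2

/-- A linear functional on the intersection of an `ℓ₁`-ball and an `ℓ_∞`-ball is dominated by its
value at a sparse vector of signs. -/
lemma exists_signType_sum_mul_le {ι : Type*} [Fintype ι] [DecidableEq ι] (a r : ι → ℝ) {c : ℝ}
    {S : ℕ} (hc : ∀ k, |a k| ≤ c) (hsum : ∑ k, |a k| ≤ c * S) :
    ∃ b : ι → SignType, (Finset.univ.filter fun k => b k ≠ 0).card ≤ S ∧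
      ∑ k, a k * r k ≤ c * ∑ k, (b k : ℝ) * r k := by
  have hmul : ∀ k, a k * r k ≤ |a k| * |r k| := fun k => by
    rw [← abs_mul]; exact le_abs_self _
  rcases le_total (Fintype.card ι) S with hS | hS
  · refine ⟨fun k => SignType.sign (r k), (Finset.card_le_univ _).trans hS, ?_⟩
    rw [Finset.mul_sum]
    refine Finset.sum_le_sum fun k _ => (hmul k).trans ?_
    rw [sign_mul_self]
    gcongr
    exact hc k
  · obtain ⟨A, hA, htop⟩ := exists_card_eq_forall_le (fun k => |r k|) hS
    refine ⟨fun k => if k ∈ A then SignType.sign (r k) else 0, ?_, ?_⟩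
    · refine hA ▸ Finset.card_le_card fun k hk => ?_
      by_contra h
      simp [h] at hk
    have hb : ∑ k, ((if k ∈ A then SignType.sign (r k) else 0 : SignType) : ℝ) * r k =
        ∑ k ∈ A, |r k| := by
      rw [← Finset.sum_subset (Finset.subset_univ A)]
      · exact Finset.sum_congr rfl fun k hk => by rw [if_pos hk, sign_mul_self]
      · intro k _ hk; simp [hk]
    rw [hb]
    rcases A.eq_empty_or_nonempty with rfl | hne
    · have hS0 : S = 0 := by simpa using hA.symm
      subst hS0
      simp only [Finset.sum_empty, mul_zero, Nat.cast_zero] at hsum ⊢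
      refine (Finset.sum_nonpos fun k hk => (hmul k).trans ?_)
      have : |a k| ≤ 0 := (Finset.single_le_sum (fun i _ => abs_nonneg (a i)) hk).trans hsum
      exact mul_nonpos_of_nonpos_of_nonneg this (abs_nonneg _)
    obtain ⟨i₀, hi₀, hmin⟩ := Finset.exists_min_image A (fun k => |r k|) hne
    -- τ is the least of the S largest magnitudes of r. Mass of a outside A earns at most τ per
    -- unit, while unused capacity inside A earns at least τ per unit, so moving the mass into A
    -- does not decrease the functional.
    set τ := |r i₀|
    have hτ : 0 ≤ τ := abs_nonneg _
    have h1 : ∑ k, a k * r k ≤ ∑ k ∈ A, |a k| * |r k| + ∑ k ∈ Aᶜ, |a k| * τ := by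
      rw [← Finset.sum_add_sum_compl A]
      refine add_le_add (Finset.sum_le_sum fun k _ => hmul k)
        (Finset.sum_le_sum fun k hk => (hmul k).trans ?_)
      exact mul_le_mul_of_nonneg_left (htop i₀ hi₀ k (Finset.mem_compl.1 hk)) (abs_nonneg _)
    have h2 : 0 ≤ ∑ k ∈ A, (c - |a k|) * (|r k| - τ) :=
      Finset.sum_nonneg fun k hk => mul_nonneg (sub_nonneg.2 (hc k)) (sub_nonneg.2 (hmin k hk))
    have h3 : ∑ k ∈ A, (c - |a k|) * (|r k| - τ) =
        c * ∑ k ∈ A, |r k| - ∑ k ∈ A, |a k| * |r k| - c * S * τ + (∑ k ∈ A, |a k|) * τ := by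
      rw [← hA, Finset.mul_sum, Finset.sum_mul, ← Finset.sum_sub_distrib]
      have : c * (A.card : ℝ) * τ = ∑ k ∈ A, c * τ := by
        rw [Finset.sum_const, nsmul_eq_mul]; ring
      rw [this, ← Finset.sum_sub_distrib, ← Finset.sum_add_distrib]
      exact Finset.sum_congr rfl fun k _ => by ring
    have h4 : (∑ k ∈ A, |a k| + ∑ k ∈ Aᶜ, |a k|) * τ ≤ c * S * τ := by
      rw [Finset.sum_add_sum_compl]
      exact mul_le_mul_of_nonneg_right hsum hτ
    rw [← Finset.sum_mul] at h1
    linarith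

/-- Sign patterns with at most `S` nonzero entries. -/
def signPatterns (N S : ℕ) : Finset (Fin N → SignType) :=
  Finset.univ.filter fun b => (Finset.univ.filter fun k => b k ≠ 0).card ≤ S

/-- A pattern is recovered from S indices covering its support, with repetitions allowed, and from
its values there. -/
lemma card_signPatterns_le {N : ℕ} (hN : 0 < N) (S : ℕ) :
    (signPatterns N S).card ≤ (3 * N) ^ S := by
  classical
  have : ∀ b : Fin N → SignType, ∃ f : Fin S → Fin N, b ∈ signPatterns N S →
      ∀ k, b k ≠ 0 → ∃ i, f i = k := by
    intro b
    by_cases hb : b ∈ signPatterns N S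
    · set A := Finset.univ.filter fun k => b k ≠ 0 with hA
      have hcard : A.card ≤ S := (Finset.mem_filter.1 hb).2
      obtain ⟨e⟩ := Function.Embedding.nonempty_of_card_le (α := A) (β := Fin S)
        (by simpa using hcard)
      refine ⟨Function.extend e Subtype.val fun _ => ⟨0, hN⟩, fun _ k hk => ?_⟩
      have hkA : k ∈ A := by simp [hA, hk]
      exact ⟨e ⟨k, hkA⟩, e.injective.extend_apply _ _ _⟩
    · exact ⟨fun _ => ⟨0, hN⟩, fun h => absurd h hb⟩
  choose f hf using this
  have hinj : Set.InjOn (fun b : Fin N → SignType => (f b, fun i => b (f b i)))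
      (signPatterns N S) := by
    intro b hb b' hb' h
    simp only [Prod.mk.injEq] at h
    obtain ⟨h1, h2⟩ := h
    have hon : ∀ i, b (f b i) = b' (f b i) := fun i => by
      have := congrFun h2 i
      rw [← h1] at this
      exact this
    ext1 k
    by_cases hk : b k = 0
    · by_contra hne
      obtain ⟨i, hi⟩ := hf b' hb' k (fun h0 => hne (hk.trans h0.symm))
      rw [← h1] at hi
      exact hne (hi ▸ hon i)
    · obtain ⟨i, hi⟩ := hf b hb k hk
      exact hi ▸ hon i
  calc (signPatterns N S).card ≤ (Finset.univ : Finset ((Fin S → Fin N) × (Fin S → SignType))).card :=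
        Finset.card_le_card_of_injOn _ (fun _ _ => Finset.mem_coe.2 (Finset.mem_univ _)) hinj
    _ = (3 * N) ^ S := by
        have : Fintype.card SignType = 3 := rfl
        simp [this, mul_pow, mul_comm]

/-- The filter whose Fourier transform is a sign pattern. -/
noncomputable def signFilter (n : ℕ) (b : Fin (2 * n + 1) → SignType) : ℤ → ℂ :=
  synth n fun k => ((b k : ℝ) : ℂ)

lemma signType_abs_le (b : SignType) : |(b : ℝ)| ≤ 1 := by cases b <;> simp

lemma sum_abs_signType_le {N S : ℕ} {b : Fin N → SignType} (hb : b ∈ signPatterns N S) :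
    ∑ k, |(b k : ℝ)| ≤ S := by
  have hcard : (Finset.univ.filter fun k => b k ≠ 0).card ≤ S := (Finset.mem_filter.1 hb).2
  rw [← Finset.sum_filter_of_ne (p := fun k => b k ≠ 0) (fun k _ h h0 => h (by simp [h0]))]
  calc _ ≤ ∑ k ∈ Finset.univ.filter fun k => b k ≠ 0, (1 : ℝ) :=
        Finset.sum_le_sum fun k _ => signType_abs_le _
    _ ≤ S := by rw [Finset.sum_const, nsmul_eq_mul, mul_one]; exact_mod_cast hcard

lemma norm_trigPoly_signFilter_le {n S : ℕ} (hS : 1 ≤ S) {b : Fin (2 * n + 1) → SignType}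
    (hb : b ∈ signPatterns (2 * n + 1) S) (θ : ℝ) :
    ‖trigPoly n (signFilter n b) θ‖ ≤ 4 + 2 * Real.log S := by
  refine norm_trigPoly_synth_le hS (fun k => ?_) ?_ θ
  · rw [Complex.norm_real]; exact signType_abs_le _
  · refine le_trans (Finset.card_le_card fun k hk => ?_) (Finset.mem_filter.1 hb).2
    simp only [Finset.mem_filter, Finset.mem_univ, true_and] at hk ⊢
    exact fun h => hk (by simp [h])

lemma sum_norm_sq_signFilter_le {n S : ℕ} {b : Fin (2 * n + 1) → SignType}
    (hb : b ∈ signPatterns (2 * n + 1) S) :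
    (2 * n + 1) * ∑ t ∈ Finset.Icc (-(n : ℤ)) n, ‖signFilter n b t‖ ^ 2 ≤ S := by
  rw [signFilter, sum_norm_sq_synth]
  refine le_trans (Finset.sum_le_sum fun k _ => ?_) (sum_abs_signType_le hb)
  rw [Complex.norm_real, Real.norm_eq_abs]
  exact pow_le_of_le_one (abs_nonneg _) (signType_abs_le _) two_ne_zero

/-- The value at 0 is the diagonal of the convolution matrix; it controls the trace of the pairing
between noise and filtered noise. -/
lemma norm_signFilter_zero_le {n S : ℕ} {b : Fin (2 * n + 1) → SignType}
    (hb : b ∈ signPatterns (2 * n + 1) S) : (2 * n + 1) * ‖signFilter n b 0‖ ≤ S := by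
  have hN : (0 : ℝ) < 2 * n + 1 := by positivity
  have h1 := norm_two_mul_add_one n
  rw [signFilter, synth_zero_index, norm_mul, norm_inv, h1, mul_inv_cancel_left₀ hN.ne']
  refine (norm_sum_le _ _).trans (le_trans (Finset.sum_le_sum fun k _ => ?_)
    (sum_abs_signType_le hb))
  rw [Complex.norm_real, Real.norm_eq_abs]

/-- Filters on `{-n, ..., n}` whose Fourier transform satisfies an `ℓ_∞` and an `ℓ₁` bound. -/
structure HasSparseSpectrum (n S : ℕ) (c : ℝ) (φ : ℤ → ℂ) : Prop where
  mem : φ ∈ bandLimited n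
  nonneg : 0 ≤ c
  norm_le : ∀ k : Fin (2 * n + 1), ‖trigPoly n φ (dftFreq n k)‖ ≤ c
  sum_le : ∑ k : Fin (2 * n + 1), ‖trigPoly n φ (dftFreq n k)‖ ≤ c * S

/-- A real linear functional of a filter with sparse spectrum is dominated by its values at
sign filters. -/
lemma HasSparseSpectrum.exists_signFilter {n S : ℕ} {c : ℝ} {φ : ℤ → ℂ}
    (hφ : HasSparseSpectrum n S c φ) (ℓ : (ℤ → ℂ) →ₗ[ℝ] ℝ) :
    ∃ b ∈ signPatterns (2 * n + 1) S, ∃ b' ∈ signPatterns (2 * n + 1) S,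
      ℓ φ ≤ c * ℓ (signFilter n b) + c * ℓ (Complex.I • signFilter n b') := by
  classical
  set a : Fin (2 * n + 1) → ℂ := fun k => trigPoly n φ (dftFreq n k) with ha
  let f : Fin (2 * n + 1) → ℤ → ℂ := fun k => synth n (Pi.single k 1)
  have hf : ∀ a : Fin (2 * n + 1) → ℂ, synth n a = ∑ k, a k • f k := by
    intro a
    ext τ
    simp only [f, synth, Finset.sum_apply, Pi.smul_apply, smul_eq_mul]
    split_ifs
    · rw [Finset.mul_sum]
      refine Finset.sum_congr rfl fun k _ => ?_
      simp [Pi.single_apply]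
      ring
    · simp
  have hfR : ∀ a : Fin (2 * n + 1) → ℝ, synth n (fun k => (a k : ℂ)) = ∑ k, a k • f k := by
    intro a
    rw [hf]
    rfl
  have hφ' : φ = ∑ k, (a k).re • f k + ∑ k, (a k).im • Complex.I • f k := by
    rw [← synth_trigPoly hφ.mem, hf, ← Finset.sum_add_distrib]
    refine Finset.sum_congr rfl fun k _ => ?_
    ext τ
    simp only [Pi.smul_apply, Pi.add_apply, smul_eq_mul, Complex.real_smul]
    nth_rewrite 1 [← Complex.re_add_im (trigPoly n φ (dftFreq n k))]
    ring
  obtain ⟨b, hb, h1⟩ := exists_signType_sum_mul_le (fun k => (a k).re) (fun k => ℓ (f k))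
    (fun k => (Complex.abs_re_le_norm _).trans (hφ.norm_le k))
    ((Finset.sum_le_sum fun k _ => Complex.abs_re_le_norm _).trans hφ.sum_le)
  obtain ⟨b', hb', h2⟩ := exists_signType_sum_mul_le (fun k => (a k).im)
    (fun k => ℓ (Complex.I • f k))
    (fun k => (Complex.abs_im_le_norm _).trans (hφ.norm_le k))
    ((Finset.sum_le_sum fun k _ => Complex.abs_im_le_norm _).trans hφ.sum_le)
  refine ⟨b, Finset.mem_filter.2 ⟨Finset.mem_univ _, hb⟩, b',
    Finset.mem_filter.2 ⟨Finset.mem_univ _, hb'⟩, ?_⟩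
  have h3 : ℓ (signFilter n b) = ∑ k, (b k : ℝ) * ℓ (f k) := by
    rw [signFilter, hfR, map_sum]; simp
  have h4 : ℓ (Complex.I • signFilter n b') = ∑ k, (b' k : ℝ) * ℓ (Complex.I • f k) := by
    rw [signFilter, hfR, Finset.smul_sum, map_sum]
    refine Finset.sum_congr rfl fun k _ => ?_
    rw [smul_comm, map_smul, smul_eq_mul]
  rw [h3, h4, hφ', map_add, map_sum, map_sum]
  simp only [map_smul, smul_eq_mul]
  exact add_le_add h1 h2

lemma hasSparseSpectrum_of_feasible {s n : ℕ} (hs : 1 ≤ s) {φ : ℤ → ℂ}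
    (hφ : φ ∈ feasibleFilters s n) : HasSparseSpectrum n (18 * s) cStar φ := by
  obtain ⟨hmem, hle⟩ := hφ
  have hN : (0 : ℝ) < 2 * n + 1 := by positivity
  have hsq : 0 < Real.sqrt (2 * n + 1) := Real.sqrt_pos.2 hN
  have hs' : (0 : ℝ) < 18 * s := by
    have : (1 : ℝ) ≤ s := by exact_mod_cast hs
    linarith
  have hc : 0 ≤ cStar := by unfold cStar; positivity
  have hnorm : ∀ k : Fin (2 * n + 1), ‖dft n φ k‖ = (Real.sqrt (2 * n + 1))⁻¹ *
      ‖trigPoly n φ (dftFreq n k)‖ := fun k => by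
    rw [dft_eq_trigPoly, norm_mul, norm_inv, Complex.norm_real, Real.norm_of_nonneg hsq.le]
  have h1 := (le_max_left _ _).trans hle
  have h2 := (le_max_right _ _).trans hle
  refine ⟨hmem, hc, fun k => ?_, ?_⟩
  · have h3 : ‖dft n φ k‖ ≤ linfNorm (dft n φ) :=
      le_ciSup (f := fun k => ‖dft n φ k‖) (Set.finite_range _).bddAbove k
    have h4 := (mul_le_mul_of_nonneg_left h3 hs'.le).trans h2
    rw [hnorm, le_div_iff₀ hsq] at h4
    have h5 : 18 * (s : ℝ) * ((Real.sqrt (2 * n + 1))⁻¹ * ‖trigPoly n φ (dftFreq n k)‖) *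
        Real.sqrt (2 * n + 1) = 18 * s * ‖trigPoly n φ (dftFreq n k)‖ := by field_simp
    rw [h5] at h4
    refine le_of_mul_le_mul_left (h4.trans_eq ?_) hs'
    ring
  · simp only [l1Norm, hnorm, ← Finset.mul_sum] at h1
    rw [le_div_iff₀ hsq, mul_comm, mul_inv_cancel_left₀ hsq.ne'] at h1
    refine h1.trans_eq ?_
    push_cast
    ring

/-- This lets the reproducing filter compete in the minimization; `cStar ≥ 1` is all that is needed.
-/
lemma feasible_of_hasSparseSpectrum_one {s n : ℕ} (hs : 1 ≤ s) {φ : ℤ → ℂ}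
    (hφ : HasSparseSpectrum n (18 * s) 1 φ) : φ ∈ feasibleFilters s n := by
  have hN : (0 : ℝ) < 2 * n + 1 := by positivity
  have hsq : 0 < Real.sqrt (2 * n + 1) := Real.sqrt_pos.2 hN
  have hs' : (0 : ℝ) ≤ 18 * s := by positivity
  have hc : 1 ≤ cStar := by
    unfold cStar
    have : 0 ≤ 2.16 * Real.pi ^ 2 := by positivity
    linarith
  have hnorm : ∀ k : Fin (2 * n + 1), ‖dft n φ k‖ = (Real.sqrt (2 * n + 1))⁻¹ *
      ‖trigPoly n φ (dftFreq n k)‖ := fun k => by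
    rw [dft_eq_trigPoly, norm_mul, norm_inv, Complex.norm_real, Real.norm_of_nonneg hsq.le]
  have hle : 18 * (s : ℝ) / Real.sqrt (2 * n + 1) ≤ 18 * cStar * s / Real.sqrt (2 * n + 1) := by
    gcongr
    nlinarith
  refine ⟨hφ.mem, max_le ?_ ?_⟩ <;> refine le_trans ?_ hle
  · simp only [l1Norm, hnorm, ← Finset.mul_sum]
    rw [div_eq_inv_mul]
    have := hφ.sum_le
    push_cast at this
    gcongr
    linarith
  · rw [div_eq_mul_inv]
    gcongr
    refine ciSup_le fun k => ?_
    rw [hnorm]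
    exact mul_le_of_le_one_right (by positivity) (hφ.norm_le k)

/-! ### The reproducing filter -/

/-- The delay is injective, so on a finite-dimensional invariant subspace it is bijective and
backward shifts also preserve X. -/
lemma IsShiftInvariant.shift_mem {X : Submodule ℂ (ℤ → ℂ)} (hX : IsShiftInvariant X)
    [Module.Finite ℂ X] {x : ℤ → ℂ} (hx : x ∈ X) (h : ℤ) : (fun t => x (t + h)) ∈ X := by
  have hinj : Function.Injective (delay.restrict hX) := by
    intro a b hab
    ext t
    have := congrFun (congrArg Subtype.val hab) (t + 1)
    simpa [delay, LinearMap.restrict_apply] using this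
  have hsurj := LinearMap.injective_iff_surjective.1 hinj
  have hfwd : ∀ y ∈ X, (fun t => y (t + 1)) ∈ X := by
    intro y hy
    obtain ⟨z, hz⟩ := hsurj ⟨y, hy⟩
    have : (fun t => y (t + 1)) = z := by
      ext t
      have := congrFun (congrArg Subtype.val hz) (t + 1)
      simpa [delay, LinearMap.restrict_apply] using this.symm
    rw [this]
    exact z.2
  induction h with
  | zero => simpa using hx
  | succ i ih =>
    have := hfwd _ ih
    refine (congrArg (· ∈ X) ?_).mp this
    ext t
    congr 1
    ring
  | pred i ih =>
    have := hX _ ih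
    refine (congrArg (· ∈ X) ?_).mp this
    ext t
    simp only [delay, LinearMap.coe_mk, AddHom.coe_mk]
    congr 1
    ring

/-- The averaged autocorrelation of a family of vectors indexed by `{0, ..., m}`. -/
noncomputable def autocorrelation {ι : Type*} [Fintype ι] (m : ℕ)
    (w : ι → EuclideanSpace ℂ (Fin (m + 1))) : ℤ → ℂ := fun τ =>
  (m + 1 : ℂ)⁻¹ * ∑ j, ∑ t : Fin (m + 1), ∑ t' : Fin (m + 1),
    if ((t : ℕ) : ℤ) - (t' : ℕ) = τ then w j t * (starRingEnd ℂ) (w j t') else 0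

section Autocorrelation

variable {ι : Type*} [Fintype ι] {m : ℕ} (w : ι → EuclideanSpace ℂ (Fin (m + 1)))

lemma autocorrelation_mem {n : ℕ} (hmn : m ≤ n) : autocorrelation m w ∈ bandLimited n := by
  intro τ hτ
  simp only [autocorrelation]
  refine mul_eq_zero_of_right _ (Finset.sum_eq_zero fun j _ => Finset.sum_eq_zero fun t _ =>
    Finset.sum_eq_zero fun t' _ => if_neg ?_)
  rintro rfl
  have := t.2; have := t'.2
  rw [lt_abs] at hτ
  omega

lemma sum_autocorrelation_mul {n : ℕ} (hmn : m ≤ n) (F : ℤ → ℂ) :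
    ∑ τ ∈ Finset.Icc (-(n : ℤ)) n, autocorrelation m w τ * F τ =
      (m + 1 : ℂ)⁻¹ * ∑ j, ∑ t : Fin (m + 1), ∑ t' : Fin (m + 1),
        w j t * (starRingEnd ℂ) (w j t') * F ((t : ℕ) - (t' : ℕ)) := by
  simp only [autocorrelation, mul_assoc]
  rw [← Finset.mul_sum]
  congr 1
  simp only [Finset.sum_mul]
  rw [Finset.sum_comm]
  refine Finset.sum_congr rfl fun j _ => ?_
  rw [Finset.sum_comm]
  refine Finset.sum_congr rfl fun t _ => ?_
  rw [Finset.sum_comm]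
  refine Finset.sum_congr rfl fun t' _ => ?_
  simp only [ite_mul, zero_mul]
  rw [Finset.sum_ite_eq, if_pos, mul_assoc]
  have := t.2; have := t'.2
  rw [Finset.mem_Icc]
  omega

/-- The vector of values of a pure frequency on `{0, ..., m}`. -/
noncomputable def expVec (m : ℕ) (θ : ℝ) : EuclideanSpace ℂ (Fin (m + 1)) :=
  WithLp.toLp 2 fun t => Complex.exp (θ * (t : ℕ) * Complex.I)

lemma norm_expVec_sq (m : ℕ) (θ : ℝ) : ‖expVec m θ‖ ^ 2 = m + 1 := by
  rw [EuclideanSpace.norm_sq_eq]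
  have : ∀ t : Fin (m + 1), ‖expVec m θ t‖ = 1 := fun t => by
    have := Complex.norm_exp_ofReal_mul_I (θ * (t : ℕ))
    push_cast at this
    exact this
  simp [this]

lemma trigPoly_autocorrelation {n : ℕ} (hmn : m ≤ n) (θ : ℝ) :
    trigPoly n (autocorrelation m w) θ =
      (((m + 1 : ℝ)⁻¹ * ∑ j, ‖inner ℂ (w j) (expVec m θ)‖ ^ 2 : ℝ) : ℂ) := by
  have h1 : trigPoly n (autocorrelation m w) θ = ∑ τ ∈ Finset.Icc (-(n : ℤ)) n,
      autocorrelation m w τ * Complex.exp (-(θ * τ * Complex.I)) :=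
    Finset.sum_congr rfl fun τ _ => mul_comm _ _
  rw [h1, sum_autocorrelation_mul w hmn fun τ => Complex.exp (-(θ * τ * Complex.I))]
  push_cast
  congr 1
  refine Finset.sum_congr rfl fun j _ => ?_
  rw [← Complex.conj_mul', PiLp.inner_apply, map_sum, Finset.sum_mul_sum]
  refine Finset.sum_congr rfl fun t _ => Finset.sum_congr rfl fun t' _ => ?_
  have : Complex.exp (-(θ * (((t : ℕ) : ℂ) - (t' : ℕ)) * Complex.I)) =
      (starRingEnd ℂ) (Complex.exp (θ * (t : ℕ) * Complex.I)) *
        Complex.exp (θ * (t' : ℕ) * Complex.I) := by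
    rw [← Complex.exp_conj, ← Complex.exp_add]
    congr 1
    simp
    ring
  push_cast [this]
  simp [expVec]
  ring

/-- By inversion at 0, this value gives the sum of the nonnegative transform over the grid, that is,
its ℓ₁-norm. -/
lemma autocorrelation_zero (hw : Orthonormal ℂ w) :
    autocorrelation m w 0 = (m + 1 : ℂ)⁻¹ * Fintype.card ι := by
  simp only [autocorrelation]
  congr 1
  have : ∀ j, ∑ t : Fin (m + 1), ∑ t' : Fin (m + 1),
      (if ((t : ℕ) : ℤ) - (t' : ℕ) = 0 then w j t * (starRingEnd ℂ) (w j t') else 0) = 1 := by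
    intro j
    have h1 : ∀ t t' : Fin (m + 1), (((t : ℕ) : ℤ) - (t' : ℕ) = 0) ↔ t = t' := fun t t' => by
      rw [Fin.ext_iff]; omega
    simp only [h1, Finset.sum_ite_eq, Finset.mem_univ, if_true]
    have h2 : inner ℂ (w j) (w j) = (1 : ℂ) := by
      rw [inner_self_eq_norm_sq_to_K, hw.1 j]; simp
    rw [← h2, PiLp.inner_apply]
    rfl
  simp [this]

end Autocorrelation

/-- Restriction of a sequence to `{0, ..., m}`. -/
def restrictFin (m : ℕ) : (ℤ → ℂ) →ₗ[ℂ] EuclideanSpace ℂ (Fin (m + 1)) where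
  toFun x := WithLp.toLp 2 fun t => x (t : ℕ)
  map_add' _ _ := rfl
  map_smul' _ _ := rfl

/-- A shift-invariant subspace of dimension at most `s` is reproduced by a filter on
`{-m, ..., m}` whose transform takes values in `[0, 1]` and has average at most `s / (m + 1)`. -/
lemma exists_reproducing_filter {s m n : ℕ} (hn : n = 9 * m) {X : Submodule ℂ (ℤ → ℂ)}
    (hX : IsShiftInvariant X) [Module.Finite ℂ X] (hdim : Module.finrank ℂ X ≤ s) :
    ∃ φ, HasSparseSpectrum n (18 * s) 1 φ ∧ ∀ x ∈ X, conv φ x = x := by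
  have hmn : m ≤ n := by omega
  set K := X.map (restrictFin m)
  set b := stdOrthonormalBasis ℂ K
  set w : Fin (Module.finrank ℂ K) → EuclideanSpace ℂ (Fin (m + 1)) := fun j => b j with hwdef
  have hw : Orthonormal ℂ w := b.orthonormal.comp_linearIsometry K.subtypeₗᵢ
  have hd : Module.finrank ℂ K ≤ s := (Submodule.finrank_map_le _ _).trans hdim
  have hm : (0 : ℝ) < m + 1 := by positivity
  have hmC : (m + 1 : ℂ) ≠ 0 := by exact_mod_cast Nat.succ_ne_zero m
  set φ := autocorrelation m w
  have hmem : φ ∈ bandLimited n := autocorrelation_mem w hmn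
  have hnn : ∀ θ, 0 ≤ (m + 1 : ℝ)⁻¹ * ∑ j, ‖inner ℂ (w j) (expVec m θ)‖ ^ 2 :=
    fun θ => by positivity
  have hnorm : ∀ θ, ‖trigPoly n φ θ‖ = (m + 1 : ℝ)⁻¹ * ∑ j, ‖inner ℂ (w j) (expVec m θ)‖ ^ 2 :=
    fun θ => by rw [trigPoly_autocorrelation w hmn, Complex.norm_real, Real.norm_of_nonneg (hnn θ)]
  refine ⟨φ, ⟨hmem, zero_le_one, fun k => ?_, ?_⟩, fun x hx => ?_⟩
  · rw [hnorm, inv_mul_le_iff₀ hm, mul_one, ← norm_expVec_sq m (dftFreq n k)]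
    exact hw.sum_inner_products_le _
  · have h1 : ((∑ k : Fin (2 * n + 1), ‖trigPoly n φ (dftFreq n k)‖ : ℝ) : ℂ) =
        (((2 * n + 1) * ((m + 1 : ℝ)⁻¹ * Module.finrank ℂ K) : ℝ) : ℂ) := by
      have h2 := trigPoly_inversion n φ (t := 0) (by simp)
      have h3 : φ 0 = (m + 1 : ℂ)⁻¹ * Fintype.card (Fin (Module.finrank ℂ K)) :=
        autocorrelation_zero w hw
      rw [h3, Fintype.card_fin] at h2
      push_cast
      rw [← h2]
      refine Finset.sum_congr rfl fun k _ => ?_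
      rw [hnorm, trigPoly_autocorrelation w hmn]
      simp
    have h2 : ∑ k : Fin (2 * n + 1), ‖trigPoly n φ (dftFreq n k)‖ =
        (2 * n + 1) * ((m + 1 : ℝ)⁻¹ * Module.finrank ℂ K) := by exact_mod_cast h1
    rw [h2, one_mul, ← mul_assoc, ← div_eq_mul_inv]
    have hd' : (Module.finrank ℂ K : ℝ) ≤ s := by exact_mod_cast hd
    -- The constant 18 comes from here: 2n + 1 = 18m + 1 ≤ 18(m + 1).
    have hN : (2 * n + 1 : ℝ) / (m + 1) ≤ 18 := by
      rw [div_le_iff₀ hm, hn]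
      push_cast
      linarith
    push_cast
    gcongr
  · ext u
    rw [conv_eq_sum hmem, sum_autocorrelation_mul w hmn fun τ => x (u - τ)]
    -- For fixed t the double sum is coordinate t of the orthogonal projection onto K of a translate
    -- of x. The translate already lies in K, so the coordinate is x u, and averaging over t changes
    -- nothing.
    have key : ∀ t : Fin (m + 1), ∑ j, ∑ t' : Fin (m + 1),
        w j t * (starRingEnd ℂ) (w j t') * x (u - ((t : ℕ) - (t' : ℕ))) = x u := by
      intro t
      set g : ℤ → ℂ := fun r => x (r + (u - (t : ℕ))) with hg
      have hgX : g ∈ X := hX.shift_mem hx _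
      have hgK : restrictFin m g ∈ K := Submodule.mem_map_of_mem hgX
      have h1 := congrArg (fun v : K => (v : EuclideanSpace ℂ (Fin (m + 1))) t)
        (b.sum_repr' ⟨restrictFin m g, hgK⟩)
      simp only [Submodule.coe_sum, Submodule.coe_smul, Submodule.coe_inner, WithLp.ofLp_sum,
        Finset.sum_apply, PiLp.smul_apply, smul_eq_mul] at h1
      have h2 : (restrictFin m g) t = x u := congrArg x (by ring)
      rw [h2] at h1
      rw [← h1]
      refine Finset.sum_congr rfl fun j _ => ?_
      rw [PiLp.inner_apply, Finset.sum_mul]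
      refine Finset.sum_congr rfl fun t' _ => ?_
      have h3 : (restrictFin m g) t' = x (u - ((t : ℕ) - (t' : ℕ))) := by
        exact congrArg x (by ring)
      rw [h3]
      simp [hwdef]
      ring
    rw [Finset.sum_comm, Finset.sum_congr rfl fun t _ => key t]
    simp [hmC]

/-! ### Existence of optimal filters -/

lemma continuous_dft (n : ℕ) (k : Fin (2 * n + 1)) : Continuous fun u : ℤ → ℂ => dft n u k := by
  unfold dft
  fun_prop

lemma isCompact_feasibleFilters {s : ℕ} (hs : 1 ≤ s) (n : ℕ) :
    IsCompact (feasibleFilters s n) := by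
  have hs' : (0 : ℝ) < 18 * s := by
    have : (1 : ℝ) ≤ s := by exact_mod_cast hs
    linarith
  refine (isCompact_univ_pi fun _ : ℤ =>
    isCompact_closedBall (0 : ℂ) (cStar * (18 * s : ℕ))).of_isClosed_subset ?_ ?_
  · have h : feasibleFilters s n = {φ | ∀ t : ℤ, (n : ℤ) < |t| → φ t = 0} ∩
        ({φ | ∑ k, ‖dft n φ k‖ ≤ 18 * cStar * s / Real.sqrt (2 * n + 1)} ∩
          {φ | ∀ k, 18 * s * ‖dft n φ k‖ ≤ 18 * cStar * s / Real.sqrt (2 * n + 1)}) := by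
      ext φ
      simp only [feasibleFilters, Set.mem_ofPred_eq, Set.mem_inter_iff, max_le_iff, l1Norm]
      refine and_congr Iff.rfl (and_congr Iff.rfl ?_)
      rw [← le_div_iff₀' hs', linfNorm, ciSup_le_iff (Set.finite_range _).bddAbove]
      exact forall_congr' fun k => le_div_iff₀' hs'
    rw [h]
    refine IsClosed.inter ?_ (IsClosed.inter ?_ ?_)
    · simp only [Set.ofPred_forall]
      exact isClosed_iInter fun t => isClosed_iInter fun _ =>
        isClosed_eq (continuous_apply t) continuous_const
    · exact isClosed_le (continuous_finsetSum _ fun k _ => (continuous_dft n k).norm)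
        continuous_const
    · rw [Set.ofPred_forall]
      exact isClosed_iInter fun k => isClosed_le (continuous_const.mul (continuous_dft n k).norm)
        continuous_const
  · intro φ hφ
    obtain ⟨hmem, hc, -, hsum⟩ := hasSparseSpectrum_of_feasible hs hφ
    rw [Set.mem_univ_pi]
    intro t
    rw [mem_closedBall_zero_iff]
    by_cases ht : |t| ≤ n
    -- Inversion bounds each coordinate by the ℓ₁-norm of the transform; the gain of 1/(2n+1) is not
    -- needed for compactness.
    · have h1 := congrArg norm (trigPoly_inversion n φ (Finset.mem_Icc.2 (abs_le.1 ht)))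
      have h2 := norm_two_mul_add_one n
      rw [norm_mul, h2] at h1
      have h3 : ‖φ t‖ ≤ (2 * n + 1) * ‖φ t‖ := by
        have : 0 ≤ (n : ℝ) * ‖φ t‖ := by positivity
        linarith
      refine h3.trans (h1 ▸ (norm_sum_le _ _).trans (le_trans (Finset.sum_le_sum fun k _ => ?_) hsum))
      rw [norm_mul]
      have := Complex.norm_exp_ofReal_mul_I (dftFreq n k * t)
      push_cast at this
      rw [this, one_mul]
    · rw [hmem t (not_le.1 ht), norm_zero]
      positivity

lemma exists_isOptimalFilter {s : ℕ} (hs : 1 ≤ s) (n : ℕ) (v : ℤ → ℂ) :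
    ∃ φ, IsOptimalFilter s n v φ := by
  have hne : (feasibleFilters s n).Nonempty := by
    have : 0 ≤ cStar := by unfold cStar; positivity
    refine ⟨0, Submodule.zero_mem _, ?_⟩
    have h0 : dft n 0 = 0 := by ext k; simp [dft]
    simp only [h0, l1Norm, linfNorm, Pi.zero_apply, norm_zero, Finset.sum_const_zero,
      ciSup_const, mul_zero, max_self]
    positivity
  have hcont : ContinuousOn (fun ψ => windowNorm n (conv ψ v - v) ^ 2) (feasibleFilters s n) := by
    have h1 : Continuous fun ψ : ℤ → ℂ => ∑ t ∈ Finset.Icc (-(n : ℤ)) n,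
        ‖∑ τ ∈ Finset.Icc (-(n : ℤ)) n, ψ τ * v (t - τ) - v t‖ ^ 2 := by fun_prop
    refine h1.continuousOn.congr fun ψ hψ => ?_
    simp only [windowNorm_sq, Pi.sub_apply, conv_eq_sum hψ.1]
  obtain ⟨φ, hφ, hmin⟩ := (isCompact_feasibleFilters hs n).exists_isMinOn hne hcont
  exact ⟨φ, hφ, hmin⟩

/-! ### Tail bounds for Gaussian quadratic forms -/

lemma inv_one_sub_le_exp {x : ℝ} (hx : |x| ≤ 1 / 2) : (1 - x)⁻¹ ≤ Real.exp (x + x ^ 2) := by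
  obtain ⟨h1, h2⟩ := abs_le.1 hx
  have h0 : 0 < 1 - x := by linarith
  rw [inv_le_iff_one_le_mul₀ h0]
  rcases le_total 0 x with h | h
  · have h3 : 1 + (x + x ^ 2) + (x + x ^ 2) ^ 2 / 2 ≤ Real.exp (x + x ^ 2) :=
      Real.quadratic_le_exp_of_nonneg (by positivity)
    refine le_trans ?_ (mul_le_mul_of_nonneg_right h3 h0.le)
    have h4 : 0 ≤ 1 - x - x ^ 2 - x ^ 3 := by
      have : x ^ 2 ≤ 1 / 4 := by nlinarith
      have : x ^ 3 ≤ 1 / 8 := by nlinarith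
      linarith
    nlinarith [mul_nonneg (sq_nonneg x) h4]
  · have h3 := Real.add_one_le_exp (x + x ^ 2)
    refine le_trans ?_ (mul_le_mul_of_nonneg_right h3 h0.le)
    nlinarith [mul_nonneg (neg_nonneg.2 h) (sq_nonneg x)]

lemma integral_exp_mul_sq_gaussianReal {y : ℝ} (hy : |y| ≤ 1 / 4) :
    ∫ x, Real.exp (y * x ^ 2) ∂(gaussianReal 0 1) = Real.sqrt (1 - 2 * y)⁻¹ := by
  obtain ⟨h1, h2⟩ := abs_le.1 hy
  have hpi := Real.pi_pos
  rw [integral_gaussianReal_eq_integral_smul one_ne_zero]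
  have h3 : ∀ x : ℝ, gaussianPDFReal 0 1 x • Real.exp (y * x ^ 2) =
      (Real.sqrt (2 * Real.pi))⁻¹ * Real.exp (-(1 / 2 - y) * x ^ 2) := by
    intro x
    rw [gaussianPDFReal, smul_eq_mul, mul_assoc, ← Real.exp_add]
    simp only [NNReal.coe_one, mul_one, sub_zero]
    congr 2
    ring
  simp_rw [h3]
  rw [integral_const_mul, integral_gaussian, ← Real.sqrt_inv, ← Real.sqrt_mul (by positivity)]
  congr 1
  have : 1 - 2 * y ≠ 0 := by linarith
  have : 1 / 2 - y ≠ 0 := by intro h; apply this; linarith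
  field_simp

lemma integrable_exp_mul_sq_gaussianReal {y : ℝ} (hy : |y| ≤ 1 / 4) :
    Integrable (fun x => Real.exp (y * x ^ 2)) (gaussianReal 0 1) := by
  -- A non-integrable function has Bochner integral 0 by convention, so a nonzero value proves
  -- integrability.
  refine Integrable.of_integral_ne_zero ?_
  rw [integral_exp_mul_sq_gaussianReal hy]
  have := (abs_le.1 hy).2
  exact (Real.sqrt_pos.2 (inv_pos.2 (by linarith))).ne'

lemma integral_exp_mul_sq_gaussianReal_le {y : ℝ} (hy : |y| ≤ 1 / 4) :
    ∫ x, Real.exp (y * x ^ 2) ∂(gaussianReal 0 1) ≤ Real.exp (y + 2 * y ^ 2) := by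
  rw [integral_exp_mul_sq_gaussianReal hy, Real.sqrt_le_left (Real.exp_pos _).le]
  refine (inv_one_sub_le_exp (x := 2 * y) (by rw [abs_mul, abs_two]; linarith)).trans_eq ?_
  rw [← Real.exp_nat_mul]
  congr 1
  push_cast
  ring

/-- A tail bound for a weighted sum of squares of independent standard Gaussian variables. -/
lemma pi_gaussianReal_tail {ι : Type*} [Fintype ι] {h : ι → ℝ} {L τ F : ℝ} (u : ℝ) (hL0 : 0 < L)
    (hL : ∀ i, |h i| ≤ L) (hτ : ∑ i, h i ≤ τ) (hF : ∑ i, h i ^ 2 ≤ F) :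
    (Measure.pi fun _ : ι => gaussianReal 0 1)
      {x | τ + F / (2 * L) + 4 * L * u ≤ ∑ i, h i * x i ^ 2} ≤ ENNReal.ofReal (Real.exp (-u)) := by
  set μ := Measure.pi fun _ : ι => gaussianReal 0 1
  -- The largest Chernoff parameter for which every l h_i stays in the range |y| ≤ 1/4 of the moment
  -- bound exp(y + 2y²).
  set l : ℝ := (4 * L)⁻¹ with hl
  have hl0 : 0 < l := by positivity
  have hsmall : ∀ i, |l * h i| ≤ 1 / 4 := fun i => by
    rw [abs_mul, abs_of_pos hl0, hl, inv_mul_le_iff₀ (by positivity)]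
    linarith [hL i]
  have hexp : ∀ x : ι → ℝ, Real.exp (l * ∑ i, h i * x i ^ 2) =
      ∏ i, Real.exp (l * h i * x i ^ 2) := fun x => by
    rw [← Real.exp_sum, Finset.mul_sum]
    exact congrArg _ (Finset.sum_congr rfl fun i _ => by ring)
  have hint : Integrable (fun x : ι → ℝ => Real.exp (l * ∑ i, h i * x i ^ 2)) μ := by
    simp_rw [hexp]
    exact Integrable.fintype_prod (f := fun i x => Real.exp (l * h i * x ^ 2))
      fun i => integrable_exp_mul_sq_gaussianReal (hsmall i)
  have hmgf : mgf (fun x : ι → ℝ => ∑ i, h i * x i ^ 2) μ l ≤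
      Real.exp (l * τ + 2 * l ^ 2 * F) := by
    simp only [mgf]
    simp_rw [hexp]
    rw [integral_fintype_prod_eq_prod (f := fun i x => Real.exp (l * h i * x ^ 2))]
    calc _ ≤ ∏ i, Real.exp (l * h i + 2 * (l * h i) ^ 2) :=
          Finset.prod_le_prod (fun i _ => integral_nonneg fun x => (Real.exp_pos _).le)
            fun i _ => integral_exp_mul_sq_gaussianReal_le (hsmall i)
      _ = Real.exp (l * ∑ i, h i + 2 * l ^ 2 * ∑ i, h i ^ 2) := by
          rw [← Real.exp_sum, Finset.mul_sum, Finset.mul_sum, ← Finset.sum_add_distrib]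
          exact congrArg _ (Finset.sum_congr rfl fun i _ => by ring)
      _ ≤ _ := by gcongr
  have h1 := measure_ge_le_exp_mul_mgf (X := fun x : ι → ℝ => ∑ i, h i * x i ^ 2) (μ := μ)
    (τ + F / (2 * L) + 4 * L * u) hl0.le hint
  rw [← ofReal_measureReal]
  refine ENNReal.ofReal_le_ofReal (h1.trans ?_)
  refine (mul_le_mul_of_nonneg_left hmgf (Real.exp_pos _).le).trans_eq ?_
  rw [← Real.exp_add]
  congr 1
  rw [hl]
  field_simp
  ring

section Quadratic

variable {E F : Type*} [NormedAddCommGroup E] [InnerProductSpace ℝ E] [FiniteDimensional ℝ E]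
  [NormedAddCommGroup F] [InnerProductSpace ℝ F] [FiniteDimensional ℝ F]

/-- A bilinear form on a Euclidean space is diagonalized, as a quadratic form, by some orthonormal
basis. -/
lemma exists_orthonormalBasis_diagonal (T' T : E →ₗ[ℝ] F) :
    ∃ v : OrthonormalBasis (Fin (Module.finrank ℝ E)) ℝ E, ∀ x : Fin (Module.finrank ℝ E) → ℝ,
      inner ℝ (T' (∑ i, x i • v i)) (T (∑ i, x i • v i)) =
        ∑ i, inner ℝ (T' (v i)) (T (v i)) * x i ^ 2 := by
  set B : E →ₗ[ℝ] E := LinearMap.adjoint T' ∘ₗ T with hB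
  -- The symmetric part has the same quadratic form, and the spectral theorem applies to it.
  set A : E →ₗ[ℝ] E := (1 / 2 : ℝ) • (B + LinearMap.adjoint B) with hA
  have hBin : ∀ z w, inner ℝ z (B w) = inner ℝ (T' z) (T w) := fun z w => by
    rw [hB, LinearMap.comp_apply, LinearMap.adjoint_inner_right]
  have hAin : ∀ z w, inner ℝ z (A w) = (1 / 2) * (inner ℝ z (B w) + inner ℝ w (B z)) := by
    intro z w
    rw [hA, LinearMap.smul_apply, LinearMap.add_apply, inner_smul_right, inner_add_right,
      LinearMap.adjoint_inner_right, real_inner_comm (B z) w]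
  have hsymm : A.IsSymmetric := fun z w => by
    rw [real_inner_comm, hAin, hAin]; ring
  have hQ : ∀ z, inner ℝ z (A z) = inner ℝ (T' z) (T z) := fun z => by
    rw [hAin, hBin]; ring
  refine ⟨hsymm.eigenvectorBasis rfl, fun x => ?_⟩
  set v := hsymm.eigenvectorBasis rfl with hv
  rw [← hQ]
  simp_rw [← hQ]
  have hAv : ∀ i, A (v i) = (hsymm.eigenvalues rfl i) • v i := fun i =>
    hsymm.apply_eigenvectorBasis rfl i
  simp only [map_sum, map_smul, hAv, sum_inner, inner_sum, inner_smul_left, inner_smul_right,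
    OrthonormalBasis.inner_eq_ite, conj_trivial]
  refine Finset.sum_congr rfl fun i _ => ?_
  simp
  ring

/-- The sum over an orthonormal basis of the squared norms of the projections onto a subspace
is at most its dimension. -/
lemma sum_norm_sq_starProjection_le (K : Submodule ℝ F) (R : E →ₗ[ℝ] F)
    (hR : ∀ z, ‖R z‖ ≤ ‖z‖) {ι : Type*} [Fintype ι] (v : OrthonormalBasis ι ℝ E) :
    ∑ i, ‖K.starProjection (R (v i))‖ ^ 2 ≤ Module.finrank ℝ K := by
  set w := stdOrthonormalBasis ℝ K
  have hadj : ∀ y, ‖LinearMap.adjoint R y‖ ≤ ‖y‖ := by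
    intro y
    have h1 : ‖LinearMap.adjoint R y‖ ^ 2 ≤ ‖LinearMap.adjoint R y‖ * ‖y‖ := by
      rw [← real_inner_self_eq_norm_sq, LinearMap.adjoint_inner_right]
      exact (real_inner_le_norm _ _).trans (mul_le_mul_of_nonneg_right (hR _) (norm_nonneg _))
    rcases (norm_nonneg (LinearMap.adjoint R y)).eq_or_lt with h | h
    · rw [← h]; exact norm_nonneg _
    · rw [sq] at h1
      exact le_of_mul_le_mul_left h1 h
  have h1 : ∀ y : F, ‖K.starProjection y‖ ^ 2 = ∑ j, inner ℝ (w j : F) y ^ 2 := by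
    intro y
    rw [Submodule.starProjection_apply, ← Submodule.coe_norm, ← w.sum_sq_inner_right]
    refine Finset.sum_congr rfl fun j _ => ?_
    rw [Submodule.inner_orthogonalProjectionOnto_eq_of_mem_left]
  simp_rw [h1]
  rw [Finset.sum_comm]
  -- With the sums exchanged, each basis vector of K contributes the squared norm of its image under
  -- the adjoint, which is a contraction like R.
  have h2 : ∀ j, ∑ i, inner ℝ (w j : F) (R (v i)) ^ 2 ≤ 1 := by
    intro j
    simp_rw [← LinearMap.adjoint_inner_left]
    simp_rw [real_inner_comm _ (LinearMap.adjoint R _)]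
    rw [v.sum_sq_inner_right]
    have h3 : ‖(w j : F)‖ = 1 := w.orthonormal.1 j
    have := hadj (w j)
    rw [h3] at this
    exact pow_le_one₀ (norm_nonneg _) this
  refine (Finset.sum_le_sum fun j _ => h2 j).trans ?_
  simp

variable [MeasurableSpace E] [BorelSpace E]

/-- A tail bound for a quadratic form of a standard Gaussian vector. -/
lemma stdGaussian_quadratic_tail (T' T : E →ₗ[ℝ] F) {L τ K : ℝ} (u : ℝ) (hL0 : 0 < L)
    (hL : ∀ z, ‖z‖ = 1 → |inner ℝ (T' z) (T z)| ≤ L)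
    (hτ : ∀ v : OrthonormalBasis (Fin (Module.finrank ℝ E)) ℝ E,
      ∑ i, inner ℝ (T' (v i)) (T (v i)) ≤ τ)
    (hK : ∀ v : OrthonormalBasis (Fin (Module.finrank ℝ E)) ℝ E,
      ∑ i, inner ℝ (T' (v i)) (T (v i)) ^ 2 ≤ K) :
    stdGaussian E {z | τ + K / (2 * L) + 4 * L * u ≤ inner ℝ (T' z) (T z)} ≤
      ENNReal.ofReal (Real.exp (-u)) := by
  obtain ⟨v, hv⟩ := exists_orthonormalBasis_diagonal T' T
  have hc : Continuous fun z => inner ℝ (T' z) (T z) :=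
    T'.continuous_of_finiteDimensional.inner T.continuous_of_finiteDimensional
  rw [stdGaussian_eq_map_pi_orthonormalBasis v, Measure.map_apply (by fun_prop)
    (measurableSet_le measurable_const hc.measurable)]
  simp only [Set.preimage_ofPred_eq, hv]
  exact pi_gaussianReal_tail u hL0 (fun i => hL _ (v.orthonormal.1 i)) (hτ v) (hK v)

/-- A tail bound for the squared norm of a linear image of a standard Gaussian vector. -/
lemma stdGaussian_norm_sq_tail (T : E →ₗ[ℝ] F) {L τ : ℝ} (u : ℝ) (hL0 : 0 < L)
    (hL : ∀ z, ‖T z‖ ≤ L * ‖z‖)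
    (hτ : ∀ v : OrthonormalBasis (Fin (Module.finrank ℝ E)) ℝ E, ∑ i, ‖T (v i)‖ ^ 2 ≤ τ) :
    stdGaussian E {z | 3 / 2 * τ + 4 * L ^ 2 * u ≤ ‖T z‖ ^ 2} ≤
      ENNReal.ofReal (Real.exp (-u)) := by
  -- Each diagonal entry is at most L², so the sum of their squares is at most L²τ; this turns τ
  -- into 3τ/2.
  have h := stdGaussian_quadratic_tail T T (L := L ^ 2) (τ := τ) (K := L ^ 2 * τ) u (by positivity)
    (fun z hz => ?_) (fun v => ?_) (fun v => ?_)
  · simp only [real_inner_self_eq_norm_sq] at h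
    refine le_trans (measure_mono fun z hz => ?_) h
    rw [Set.mem_ofPred_eq] at hz ⊢
    have : τ + L ^ 2 * τ / (2 * L ^ 2) = 3 / 2 * τ := by field_simp; ring
    rwa [this]
  · have := hL z
    rw [hz, mul_one] at this
    rw [real_inner_self_eq_norm_sq, abs_of_nonneg (sq_nonneg _)]
    gcongr
  · simp only [real_inner_self_eq_norm_sq]
    exact hτ v
  · refine le_trans ?_ (mul_le_mul_of_nonneg_left (hτ v) (sq_nonneg L))
    rw [Finset.mul_sum]
    refine Finset.sum_le_sum fun i _ => ?_
    have := hL (v i)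
    rw [v.orthonormal.1 i, mul_one] at this
    rw [real_inner_self_eq_norm_sq, sq (‖T (v i)‖ ^ 2)]
    gcongr

/-- A tail bound for the projection of a standard Gaussian vector onto a subspace. -/
lemma stdGaussian_starProjection_tail (K : Submodule ℝ F) (R : E →ₗ[ℝ] F)
    (hR : ∀ z, ‖R z‖ ≤ ‖z‖) {d : ℝ} (hd : (Module.finrank ℝ K : ℝ) ≤ d) (u : ℝ) :
    stdGaussian E {z | 3 / 2 * d + 4 * u ≤ ‖K.starProjection (R z)‖ ^ 2} ≤
      ENNReal.ofReal (Real.exp (-u)) := by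
  have h := stdGaussian_norm_sq_tail (K.starProjection.toLinearMap ∘ₗ R) (L := 1) (τ := d) u
    one_pos (fun z => by
      rw [one_mul]
      exact (K.norm_starProjection_apply_le _).trans (hR z))
    fun v => (sum_norm_sq_starProjection_le K R hR v).trans hd
  rwa [one_pow, mul_one] at h

end Quadratic

/-! ### Complex Gaussian vectors as real standard Gaussian vectors -/

section ComplexGaussian

lemma stdComplexGaussian_eq_stdGaussian : stdComplexGaussian = stdGaussian ℂ := by
  rw [stdGaussian_eq_map_pi_orthonormalBasis Complex.orthonormalBasisOneI, stdComplexGaussian,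
    ← (measurePreserving_finTwoArrow (gaussianReal 0 1)).map_eq,
    Measure.map_map (by fun_prop) (by fun_prop)]
  congr 1
  ext x
  simp [Complex.measurableEquivRealProd, MeasurableEquiv.finTwoArrow,
    Complex.ext_iff]

/-- Independence factors the characteristic function, and the product of the coordinate Gaussian
factors is that of the standard Gaussian on the whole real Euclidean space. -/
lemma map_eq_stdGaussian {ι Ω : Type*} [Fintype ι] [MeasurableSpace Ω] {P : Measure Ω}
    [IsProbabilityMeasure P] {ξ : ι → Ω → ℂ} (hlaw : ∀ i, HasLaw (ξ i) stdComplexGaussian P)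
    (hindep : iIndepFun ξ P) :
    P.map (fun ω => WithLp.toLp 2 fun i => ξ i ω) = stdGaussian (EuclideanSpace ℂ ι) := by
  have hm : AEMeasurable (fun ω => (WithLp.toLp 2 fun i => ξ i ω : EuclideanSpace ℂ ι)) P := by
    have := fun i => (hlaw i).aemeasurable
    fun_prop
  have : IsProbabilityMeasure (P.map fun ω => (WithLp.toLp 2 fun i => ξ i ω :
    EuclideanSpace ℂ ι)) := Measure.isProbabilityMeasure_map hm
  refine Measure.ext_of_charFun (E := EuclideanSpace ℂ ι) ?_
  ext t
  rw [(iIndepFun_iff_charFun_pi fun i => (hlaw i).aemeasurable).1 hindep t, charFun_stdGaussian]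
  simp_rw [fun i => (hlaw i).map_eq, stdComplexGaussian_eq_stdGaussian, charFun_stdGaussian]
  rw [← Complex.exp_sum, ← Complex.ofReal_pow, EuclideanSpace.norm_sq_eq]
  congr 1
  push_cast
  rw [← Finset.sum_div, Finset.sum_neg_distrib]

variable {I : Type*} [Fintype I]

/-- A real trace over a complex space: a complex coordinate and its multiple by i contribute
equally, whence the factor 2. It computes the traces of the quadratic forms in the noise. -/
lemma sum_re_inner_orthonormalBasis (a b : EuclideanSpace ℂ I) {ι : Type*} [Fintype ι]
    (v : OrthonormalBasis ι ℝ (EuclideanSpace ℂ I)) :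
    ∑ i, ((starRingEnd ℂ) (inner ℂ a (v i)) * inner ℂ b (v i)).re = 2 * inner ℝ a b := by
  have hre : ∀ a z : EuclideanSpace ℂ I, (inner ℂ a z : ℂ).re = inner ℝ a z := fun a z => by
    rw [PiLp.inner_apply, PiLp.inner_apply, Complex.re_sum]
    exact Finset.sum_congr rfl fun i _ => by simp [Complex.inner]
  have him : ∀ a z : EuclideanSpace ℂ I, (inner ℂ a z : ℂ).im = inner ℝ (Complex.I • a) z :=
    fun a z => by
      rw [← hre, inner_smul_left]
      simp
  have h : ∀ i, ((starRingEnd ℂ) (inner ℂ a (v i)) * inner ℂ b (v i)).re =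
      inner ℝ a (v i) * inner ℝ (v i) b +
        inner ℝ (Complex.I • a) (v i) * inner ℝ (v i) (Complex.I • b) := fun i => by
    rw [real_inner_comm b, real_inner_comm (Complex.I • b), ← hre, ← hre, ← him, ← him,
      Complex.mul_re, Complex.conj_re, Complex.conj_im]
    ring
  simp_rw [h]
  rw [Finset.sum_add_distrib, v.sum_inner_mul_inner, v.sum_inner_mul_inner, ← hre (Complex.I • a),
    inner_smul_left, inner_smul_right, ← hre]
  simp
  ring

end ComplexGaussian

/-! ### Filtering as a linear map on the noise -/

/-- Restriction of a sequence to `{-n, ..., n}`. -/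
noncomputable def restrictWindow (n : ℕ) : (ℤ → ℂ) →ₗ[ℂ] EuclideanSpace ℂ (Finset.Icc (-(n : ℤ)) n) where
  toFun u := WithLp.toLp 2 fun t => u t
  map_add' _ _ := rfl
  map_smul' _ _ := rfl

lemma restrictWindow_apply (n : ℕ) (u : ℤ → ℂ) (t : Finset.Icc (-(n : ℤ)) n) :
    restrictWindow n u t = u t := rfl

lemma windowNorm_eq_norm (n : ℕ) (u : ℤ → ℂ) : windowNorm n u = ‖restrictWindow n u‖ := by
  rw [windowNorm, EuclideanSpace.norm_eq]
  congr 1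
  exact (Finset.sum_coe_sort (Finset.Icc (-(n : ℤ)) n) fun t => ‖u t‖ ^ 2).symm

/-- Convolution with a filter on `{-n, ..., n}`, restricted to `{-n, ..., n}`. -/
noncomputable def convWindow (n : ℕ) :
    (ℤ → ℂ) →ₗ[ℂ] (ℤ → ℂ) →ₗ[ℂ] EuclideanSpace ℂ (Finset.Icc (-(n : ℤ)) n) :=
  LinearMap.mk₂ ℂ
    (fun φ v => WithLp.toLp 2 fun t => ∑ τ ∈ Finset.Icc (-(n : ℤ)) n, φ τ * v (t - τ))
    (fun φ ψ v => by ext t; simp [add_mul, Finset.sum_add_distrib])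
    (fun c φ v => by ext t; simp [mul_assoc, Finset.mul_sum])
    (fun φ v w => by ext t; simp [mul_add, Finset.sum_add_distrib])
    (fun c φ v => by ext t; simp [mul_left_comm, Finset.mul_sum])

lemma convWindow_apply (n : ℕ) (φ v : ℤ → ℂ) (t : Finset.Icc (-(n : ℤ)) n) :
    convWindow n φ v t = ∑ τ ∈ Finset.Icc (-(n : ℤ)) n, φ τ * v (t - τ) := rfl

lemma restrictWindow_conv {n : ℕ} {φ : ℤ → ℂ} (hφ : φ ∈ bandLimited n) (v : ℤ → ℂ) :
    restrictWindow n (conv φ v) = convWindow n φ v := by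
  ext t
  rw [restrictWindow_apply, convWindow_apply, conv_eq_sum hφ]

lemma convWindow_congr {n : ℕ} (φ : ℤ → ℂ) {v w : ℤ → ℂ}
    (h : ∀ t ∈ Finset.Icc (-(2 * n : ℤ)) (2 * n), v t = w t) :
    convWindow n φ v = convWindow n φ w := by
  ext t
  rw [convWindow_apply, convWindow_apply]
  refine Finset.sum_congr rfl fun τ hτ => ?_
  rw [h]
  have := Finset.mem_Icc.1 t.2
  rw [Finset.mem_Icc] at hτ ⊢
  omega

/-- Extension by zero of a vector indexed by a finite set of integers. -/
noncomputable def extendZero (I : Finset ℤ) : EuclideanSpace ℂ I →ₗ[ℂ] (ℤ → ℂ) where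
  toFun z t := if h : t ∈ I then z ⟨t, h⟩ else 0
  map_add' z w := by ext t; by_cases h : t ∈ I <;> simp [h]
  map_smul' c z := by ext t; by_cases h : t ∈ I <;> simp [h]

lemma extendZero_of_mem {I : Finset ℤ} (z : EuclideanSpace ℂ I) {t : ℤ} (h : t ∈ I) :
    extendZero I z t = z ⟨t, h⟩ := dif_pos h

lemma extendZero_of_notMem {I : Finset ℤ} (z : EuclideanSpace ℂ I) {t : ℤ} (h : t ∉ I) :
    extendZero I z t = 0 := dif_neg h

lemma sum_norm_sq_extendZero {I : Finset ℤ} (z : EuclideanSpace ℂ I) :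
    ∑ t ∈ I, ‖extendZero I z t‖ ^ 2 = ‖z‖ ^ 2 := by
  rw [EuclideanSpace.norm_sq_eq, ← Finset.sum_coe_sort]
  exact Finset.sum_congr rfl fun t _ => by rw [extendZero_of_mem z t.2]

/-- The indices of the observations that enter the window `{-n, ..., n}` after filtering. -/
noncomputable abbrev noiseWindow (n : ℕ) : Finset ℤ := Finset.Icc (-(2 * n : ℤ)) (2 * n)

lemma window_subset_noiseWindow (n : ℕ) : Finset.Icc (-(n : ℤ)) n ⊆ noiseWindow n :=
  Finset.Icc_subset_Icc (by omega) (by omega)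

/-- The noise inside the window. -/
noncomputable def innerNoise (n : ℕ) : EuclideanSpace ℂ (noiseWindow n) →ₗ[ℝ]
    EuclideanSpace ℂ (Finset.Icc (-(n : ℤ)) n) :=
  (restrictWindow n ∘ₗ extendZero (noiseWindow n)).restrictScalars ℝ

/-- The filtered noise inside the window. -/
noncomputable def filteredNoise (n : ℕ) (φ : ℤ → ℂ) : EuclideanSpace ℂ (noiseWindow n) →ₗ[ℝ]
    EuclideanSpace ℂ (Finset.Icc (-(n : ℤ)) n) :=
  (convWindow n φ ∘ₗ extendZero (noiseWindow n)).restrictScalars ℝ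

lemma innerNoise_eq (n : ℕ) (z : EuclideanSpace ℂ (noiseWindow n)) :
    innerNoise n z = restrictWindow n (extendZero (noiseWindow n) z) := rfl

lemma filteredNoise_eq (n : ℕ) (φ : ℤ → ℂ) (z : EuclideanSpace ℂ (noiseWindow n)) :
    filteredNoise n φ z = convWindow n φ (extendZero (noiseWindow n) z) := rfl

lemma norm_innerNoise_le (n : ℕ) (z : EuclideanSpace ℂ (noiseWindow n)) :
    ‖innerNoise n z‖ ≤ ‖z‖ := by
  refine le_of_sq_le_sq ?_ (norm_nonneg _)
  rw [innerNoise_eq, ← windowNorm_eq_norm, windowNorm_sq, ← sum_norm_sq_extendZero]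
  exact Finset.sum_le_sum_of_subset_of_nonneg (window_subset_noiseWindow n)
    fun _ _ _ => sq_nonneg _

/-- Bounds on a filter that control the linear map it induces on the noise. -/
structure FilterBounds (n : ℕ) (S L : ℝ) (φ : ℤ → ℂ) : Prop where
  mem : φ ∈ bandLimited n
  trigPoly_le : ∀ θ, ‖trigPoly n φ θ‖ ≤ L
  energy_le : (2 * n + 1) * ∑ t ∈ Finset.Icc (-(n : ℤ)) n, ‖φ t‖ ^ 2 ≤ S
  zero_le : (2 * n + 1) * ‖φ 0‖ ≤ S

lemma filterBounds_signFilter {n S : ℕ} (hS : 1 ≤ S) {b : Fin (2 * n + 1) → SignType}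
    (hb : b ∈ signPatterns (2 * n + 1) S) :
    FilterBounds n S (4 + 2 * Real.log S) (signFilter n b) :=
  ⟨synth_mem n _, norm_trigPoly_signFilter_le hS hb, sum_norm_sq_signFilter_le hb,
    norm_signFilter_zero_le hb⟩

lemma FilterBounds.I_smul {n : ℕ} {S L : ℝ} {φ : ℤ → ℂ} (h : FilterBounds n S L φ) :
    FilterBounds n S L (Complex.I • φ) := by
  refine ⟨Submodule.smul_mem _ _ h.mem, fun θ => ?_, ?_, ?_⟩
  · have : trigPoly n (Complex.I • φ) θ = Complex.I * trigPoly n φ θ := by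
      simp only [trigPoly, Finset.mul_sum, Pi.smul_apply, smul_eq_mul]
      exact Finset.sum_congr rfl fun _ _ => by ring
    rw [this, norm_mul, Complex.norm_I, one_mul]
    exact h.trigPoly_le θ
  · simpa using h.energy_le
  · simpa using h.zero_le

section FilterBounds

variable {n : ℕ} {S L : ℝ} {φ : ℤ → ℂ}

lemma FilterBounds.norm_filteredNoise_le (h : FilterBounds n S L φ)
    (z : EuclideanSpace ℂ (noiseWindow n)) : ‖filteredNoise n φ z‖ ≤ L * ‖z‖ := by
  have hL : 0 ≤ L := (norm_nonneg _).trans (h.trigPoly_le 0)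
  refine le_of_sq_le_sq ?_ (by positivity)
  have hz : extendZero (noiseWindow n) z ∈ bandLimited (2 * n) := fun t ht => by
    refine extendZero_of_notMem z fun hmem => ?_
    rw [noiseWindow, Finset.mem_Icc, ← abs_le] at hmem
    push_cast at ht
    omega
  have h1 := sum_norm_sq_conv_le (q := n) h.mem hz (by omega) h.trigPoly_le
  have h2 : Finset.Icc (-((2 * n : ℕ) : ℤ)) (2 * n : ℕ) = noiseWindow n := by
    push_cast; rfl
  rw [h2, sum_norm_sq_extendZero] at h1
  rw [filteredNoise_eq, ← restrictWindow_conv h.mem, ← windowNorm_eq_norm, windowNorm_sq, mul_pow]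
  exact h1

/-- The vector representing a coordinate of the filtered noise. -/
noncomputable def filterRow (n : ℕ) (φ : ℤ → ℂ) (r : ℤ) : EuclideanSpace ℂ (noiseWindow n) :=
  WithLp.toLp 2 fun t => (starRingEnd ℂ) (φ (r - t))

lemma filteredNoise_apply (hφ : φ ∈ bandLimited n) (z : EuclideanSpace ℂ (noiseWindow n))
    (r : Finset.Icc (-(n : ℤ)) n) :
    filteredNoise n φ z r = inner ℂ (filterRow n φ r) z := by
  rw [filteredNoise_eq, ← restrictWindow_conv hφ, restrictWindow_apply, conv,
    ← (Equiv.subLeft (r : ℤ)).tsum_eq]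
  simp only [Equiv.subLeft_apply, sub_sub_cancel]
  rw [tsum_eq_sum (s := noiseWindow n) fun t ht => by rw [extendZero_of_notMem z ht, mul_zero],
    PiLp.inner_apply, ← Finset.sum_coe_sort]
  refine Finset.sum_congr rfl fun t _ => ?_
  rw [extendZero_of_mem z t.2]
  simp [filterRow, mul_comm]

lemma norm_filterRow_sq_le (hφ : φ ∈ bandLimited n) (r : ℤ) :
    ‖filterRow n φ r‖ ^ 2 ≤ ∑ t ∈ Finset.Icc (-(n : ℤ)) n, ‖φ t‖ ^ 2 := by
  rw [EuclideanSpace.norm_sq_eq]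
  simp only [filterRow, RCLike.norm_conj]
  rw [Finset.sum_coe_sort (noiseWindow n) fun t => ‖φ (r - t)‖ ^ 2,
    ← Finset.sum_image (f := fun τ => ‖φ τ‖ ^ 2) (g := fun t => r - t)
      fun a _ b _ hab => by simpa using hab,
    ← Finset.sum_filter_of_ne (p := fun τ => τ ∈ Finset.Icc (-(n : ℤ)) n)]
  · exact Finset.sum_le_sum_of_subset_of_nonneg (fun τ hτ => (Finset.mem_filter.1 hτ).2)
      fun _ _ _ => sq_nonneg _
  · intro τ _ hne
    by_contra hτ
    rw [Finset.mem_Icc, ← abs_le, not_le] at hτ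
    exact hne (by simp [hφ τ hτ])

variable {ι : Type*} [Fintype ι] (v : OrthonormalBasis ι ℝ (EuclideanSpace ℂ (noiseWindow n)))

/-- This is the real squared Hilbert–Schmidt norm: each of the 2n + 1 rows contributes at most twice
the energy of the filter. -/
lemma FilterBounds.sum_norm_sq_filteredNoise_le (h : FilterBounds n S L φ) :
    ∑ i, ‖filteredNoise n φ (v i)‖ ^ 2 ≤ 2 * S := by
  simp only [EuclideanSpace.norm_sq_eq, filteredNoise_apply h.mem]
  rw [Finset.sum_comm]
  have h1 : ∀ r : Finset.Icc (-(n : ℤ)) n, ∑ i, ‖inner ℂ (filterRow n φ r) (v i)‖ ^ 2 ≤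
      2 * ∑ t ∈ Finset.Icc (-(n : ℤ)) n, ‖φ t‖ ^ 2 := by
    intro r
    have := sum_re_inner_orthonormalBasis (filterRow n φ r) (filterRow n φ r) v
    rw [real_inner_self_eq_norm_sq] at this
    refine le_trans (le_of_eq ?_) (mul_le_mul_of_nonneg_left (norm_filterRow_sq_le h.mem r)
      zero_le_two)
    rw [← this]
    refine Finset.sum_congr rfl fun i _ => ?_
    rw [Complex.conj_mul', ← Complex.ofReal_pow, Complex.ofReal_re]
  refine (Finset.sum_le_sum fun r _ => h1 r).trans ?_
  rw [Finset.sum_const, Finset.card_univ, Fintype.card_coe, Int.card_Icc, nsmul_eq_mul]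
  have h2 : ((n : ℤ) + 1 - -(n : ℤ)).toNat = 2 * n + 1 := by omega
  rw [h2]
  push_cast
  linarith [h.energy_le]

/-- The trace sees only the diagonal of the convolution matrix, whose 2n + 1 entries all equal φ 0.
-/
lemma FilterBounds.sum_inner_filteredNoise_le (h : FilterBounds n S L φ) :
    ∑ i, inner ℝ (innerNoise n (v i)) (filteredNoise n φ (v i)) ≤ 2 * S := by
  classical
  simp only [PiLp.inner_apply]
  rw [Finset.sum_comm]
  have h1 : ∀ r : Finset.Icc (-(n : ℤ)) n,
      ∑ i, inner ℝ (innerNoise n (v i) r) (filteredNoise n φ (v i) r) ≤ 2 * ‖φ 0‖ := by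
    intro r
    have hr := window_subset_noiseWindow n r.2
    set e : EuclideanSpace ℂ (noiseWindow n) := EuclideanSpace.single ⟨r, hr⟩ 1 with he
    have h2 := sum_re_inner_orthonormalBasis e (filterRow n φ r) v
    have h3 : inner ℝ e (filterRow n φ r) = (φ 0).re := by
      rw [PiLp.inner_apply, Finset.sum_eq_single ⟨(r : ℤ), hr⟩]
      · simp [he, filterRow, Complex.inner]
      · intro t _ ht; simp [he, ht]
      · simp
    rw [h3] at h2
    refine le_trans (le_of_eq ?_) (mul_le_mul_of_nonneg_left
      ((Complex.re_le_norm (φ 0))) zero_le_two)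
    rw [← h2]
    refine Finset.sum_congr rfl fun i _ => ?_
    rw [filteredNoise_apply h.mem, innerNoise_eq, restrictWindow_apply, extendZero_of_mem _ hr,
      Complex.inner, he, EuclideanSpace.inner_single_left]
    simp
    ring
  refine (Finset.sum_le_sum fun r _ => h1 r).trans ?_
  rw [Finset.sum_const, Finset.card_univ, Fintype.card_coe, Int.card_Icc, nsmul_eq_mul]
  have h2 : ((n : ℤ) + 1 - -(n : ℤ)).toNat = 2 * n + 1 := by omega
  rw [h2]
  push_cast
  linarith [h.zero_le]

lemma FilterBounds.norm_sq_tail (h : FilterBounds n S L φ) (hL : 1 ≤ L) (u : ℝ) :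
    stdGaussian (EuclideanSpace ℂ (noiseWindow n))
      {z | 3 * S + 4 * L ^ 2 * u ≤ ‖filteredNoise n φ z‖ ^ 2} ≤
        ENNReal.ofReal (Real.exp (-u)) := by
  have := stdGaussian_norm_sq_tail (filteredNoise n φ) u (by linarith) h.norm_filteredNoise_le
    fun v => h.sum_norm_sq_filteredNoise_le v
  rwa [show 3 / 2 * (2 * S) = 3 * S by ring] at this

/-- The diagonal entries are bounded by norms of filtered noise, so their squares sum to at most 2S.
With L ≥ 1 the threshold 2S + 2S/(2L) is at most 3S. The deviation term is linear in L here, not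
quadratic. -/
lemma FilterBounds.inner_tail (h : FilterBounds n S L φ) (hL : 1 ≤ L) (u : ℝ) :
    stdGaussian (EuclideanSpace ℂ (noiseWindow n))
      {z | 3 * S + 4 * L * u ≤ inner ℝ (innerNoise n z) (filteredNoise n φ z)} ≤
        ENNReal.ofReal (Real.exp (-u)) := by
  have hS : 0 ≤ S := le_trans (by positivity) h.zero_le
  have hcs : ∀ z, ‖z‖ = 1 → |inner ℝ (innerNoise n z) (filteredNoise n φ z)| ≤
      ‖filteredNoise n φ z‖ := fun z hz => by
    refine (abs_real_inner_le_norm _ _).trans ?_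
    have := norm_innerNoise_le n z
    rw [hz] at this
    exact mul_le_of_le_one_left (norm_nonneg _) this
  have := stdGaussian_quadratic_tail (innerNoise n) (filteredNoise n φ) u
    (by linarith : 0 < L)
    (fun z hz => (hcs z hz).trans (by simpa [hz] using h.norm_filteredNoise_le z))
    (fun v => h.sum_inner_filteredNoise_le v) (K := 2 * S) fun v =>
      (Finset.sum_le_sum fun i _ => by
        rw [← sq_abs]
        exact pow_le_pow_left₀ (abs_nonneg _) (hcs _ (v.orthonormal.1 i)) 2).trans
          (h.sum_norm_sq_filteredNoise_le v)
  refine le_trans (measure_mono fun z hz => ?_) this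
  rw [Set.mem_ofPred_eq] at hz ⊢
  refine le_trans ?_ hz
  have : 2 * S / (2 * L) ≤ S := by
    rw [div_le_iff₀ (by linarith)]
    nlinarith
  linarith

end FilterBounds

/-- The restrictions to `{-n, ..., n}` of the sequences of a subspace. -/
noncomputable def windowSubmodule (n : ℕ) (X : Submodule ℂ (ℤ → ℂ)) :
    Submodule ℝ (EuclideanSpace ℂ (Finset.Icc (-(n : ℤ)) n)) :=
  (X.map (restrictWindow n)).restrictScalars ℝ

/-- The Gaussian bounds are stated over ℝ, where complex dimensions double. -/
lemma finrank_windowSubmodule_le (n : ℕ) (X : Submodule ℂ (ℤ → ℂ)) [Module.Finite ℂ X] :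
    Module.finrank ℝ (windowSubmodule n X) ≤ 2 * Module.finrank ℂ X := by
  have : Module.finrank ℝ (windowSubmodule n X) =
      2 * Module.finrank ℂ (X.map (restrictWindow n)) :=
    (((X.map (restrictWindow n)).restrictScalarsEquiv ℝ ℂ _).restrictScalars ℝ).finrank_eq.trans
      (finrank_real_of_complex _)
  rw [this]
  exact Nat.mul_le_mul_left 2 (Submodule.finrank_map_le _ _)

lemma windowSubmodule_tail (n : ℕ) {s : ℕ} (X : Submodule ℂ (ℤ → ℂ)) [Module.Finite ℂ X]
    (hdim : Module.finrank ℂ X ≤ s) (u : ℝ) :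
    stdGaussian (EuclideanSpace ℂ (noiseWindow n))
      {z | 3 * s + 4 * u ≤ ‖(windowSubmodule n X).starProjection (innerNoise n z)‖ ^ 2} ≤
        ENNReal.ofReal (Real.exp (-u)) := by
  have h := stdGaussian_starProjection_tail (windowSubmodule n X) (innerNoise n)
    (norm_innerNoise_le n) (d := 2 * s) (by
      exact_mod_cast (finrank_windowSubmodule_le n X).trans (Nat.mul_le_mul_left 2 hdim)) u
  rwa [show 3 / 2 * (2 * (s : ℝ)) = 3 * s by ring] at h

/-! ### Noise bounds uniform over all filters -/

/-- The event on which the noise obeys the bounds used to control the estimator. -/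
structure GoodNoise (n S s : ℕ) (L u : ℝ) (X : Submodule ℂ (ℤ → ℂ))
    (z : EuclideanSpace ℂ (noiseWindow n)) : Prop where
  norm_sq_lt : ∀ b ∈ signPatterns (2 * n + 1) S,
    ‖filteredNoise n (signFilter n b) z‖ ^ 2 < 3 * S + 4 * L ^ 2 * u
  inner_lt : ∀ b ∈ signPatterns (2 * n + 1) S,
    inner ℝ (innerNoise n z) (filteredNoise n (signFilter n b) z) < 3 * S + 4 * L * u
  inner_I_lt : ∀ b ∈ signPatterns (2 * n + 1) S,
    inner ℝ (innerNoise n z) (filteredNoise n (Complex.I • signFilter n b) z) < 3 * S + 4 * L * u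
  proj_lt : ‖(windowSubmodule n X).starProjection (innerNoise n z)‖ ^ 2 < 3 * s + 4 * u

/-- Union bound over three families indexed by sign patterns and one projection event; the latter is
charged the size of a whole family, giving the factor 4. -/
lemma stdGaussian_not_goodNoise_le {n S s : ℕ} (hS : 1 ≤ S) (X : Submodule ℂ (ℤ → ℂ))
    [Module.Finite ℂ X] (hdim : Module.finrank ℂ X ≤ s) (u : ℝ) :
    stdGaussian (EuclideanSpace ℂ (noiseWindow n))
      {z | ¬ GoodNoise n S s (4 + 2 * Real.log S) u X z} ≤
        ENNReal.ofReal (4 * (3 * (2 * n + 1)) ^ S * Real.exp (-u)) := by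
  set L := 4 + 2 * Real.log S with hLdef
  have hL : 1 ≤ L := by
    have := Real.log_nonneg (by exact_mod_cast hS : (1 : ℝ) ≤ S)
    linarith
  set μ := stdGaussian (EuclideanSpace ℂ (noiseWindow n))
  set V := signPatterns (2 * n + 1) S
  set p := ENNReal.ofReal (Real.exp (-u))
  let A : (Fin (2 * n + 1) → SignType) → Set (EuclideanSpace ℂ (noiseWindow n)) := fun b =>
    {z | 3 * S + 4 * L ^ 2 * u ≤ ‖filteredNoise n (signFilter n b) z‖ ^ 2}
  let B : (Fin (2 * n + 1) → SignType) → Set (EuclideanSpace ℂ (noiseWindow n)) := fun b =>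
    {z | 3 * S + 4 * L * u ≤ inner ℝ (innerNoise n z) (filteredNoise n (signFilter n b) z)}
  let C : (Fin (2 * n + 1) → SignType) → Set (EuclideanSpace ℂ (noiseWindow n)) := fun b =>
    {z | 3 * S + 4 * L * u ≤
      inner ℝ (innerNoise n z) (filteredNoise n (Complex.I • signFilter n b) z)}
  let D : Set (EuclideanSpace ℂ (noiseWindow n)) :=
    {z | 3 * s + 4 * u ≤ ‖(windowSubmodule n X).starProjection (innerNoise n z)‖ ^ 2}
  have hsub : {z | ¬ GoodNoise n S s L u X z} ⊆
      (((⋃ b ∈ V, A b) ∪ ⋃ b ∈ V, B b) ∪ ⋃ b ∈ V, C b) ∪ D := by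
    intro z hz
    by_contra hcon
    simp only [Set.mem_union, Set.mem_iUnion, not_or, not_exists] at hcon
    obtain ⟨⟨⟨hA, hB⟩, hC⟩, hD⟩ := hcon
    exact hz ⟨fun b hb => not_le.1 (hA b hb), fun b hb => not_le.1 (hB b hb),
      fun b hb => not_le.1 (hC b hb), not_le.1 hD⟩
  have hunion : ∀ A : (Fin (2 * n + 1) → SignType) → Set (EuclideanSpace ℂ (noiseWindow n)),
      (∀ b ∈ V, μ (A b) ≤ p) → μ (⋃ b ∈ V, A b) ≤ (3 * (2 * n + 1)) ^ S * p := by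
    intro A hA
    refine (measure_biUnion_finset_le _ _).trans ((Finset.sum_le_sum hA).trans ?_)
    rw [Finset.sum_const, nsmul_eq_mul]
    gcongr
    exact_mod_cast card_signPatterns_le (Nat.succ_pos (2 * n)) S
  have hone : (1 : ENNReal) ≤ (3 * (2 * n + 1)) ^ S := by
    have : 1 ≤ (3 * (2 * n + 1)) ^ S := Nat.one_le_pow _ _ (by omega)
    exact_mod_cast this
  calc μ {z | ¬ GoodNoise n S s L u X z}
      ≤ μ (⋃ b ∈ V, A b) + μ (⋃ b ∈ V, B b) + μ (⋃ b ∈ V, C b) + μ D :=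
        (measure_mono hsub).trans <| (measure_union_le _ _).trans <| add_le_add
          ((measure_union_le _ _).trans <| add_le_add (measure_union_le _ _) le_rfl) le_rfl
    _ ≤ (3 * (2 * n + 1)) ^ S * p + (3 * (2 * n + 1)) ^ S * p + (3 * (2 * n + 1)) ^ S * p +
          (3 * (2 * n + 1)) ^ S * p := by
        refine add_le_add (add_le_add (add_le_add ?_ ?_) ?_) ?_
        · exact hunion A fun b hb => (filterBounds_signFilter hS hb).norm_sq_tail hL u
        · exact hunion B fun b hb => (filterBounds_signFilter hS hb).inner_tail hL u
        · exact hunion C fun b hb => (filterBounds_signFilter hS hb).I_smul.inner_tail hL u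
        · exact (windowSubmodule_tail n X hdim u).trans (le_mul_of_one_le_left' hone)
    _ = ENNReal.ofReal (4 * (3 * (2 * n + 1)) ^ S * Real.exp (-u)) := by
        rw [ENNReal.ofReal_mul (by positivity)]
        have : ENNReal.ofReal (4 * (3 * (2 * n + 1)) ^ S) = 4 * (3 * (2 * n + 1)) ^ S := by
          have h : (4 * (3 * (2 * n + 1)) ^ S : ℝ) = ((4 * (3 * (2 * n + 1)) ^ S : ℕ) : ℝ) := by
            push_cast; rfl
          rw [h, ENNReal.ofReal_natCast]
          push_cast; rfl
        rw [this]
        ring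

lemma HasSparseSpectrum.neg {n S : ℕ} {c : ℝ} {φ : ℤ → ℂ} (h : HasSparseSpectrum n S c φ) :
    HasSparseSpectrum n S c (-φ) := by
  have : ∀ θ, trigPoly n (-φ) θ = -trigPoly n φ θ := fun θ => by simp [trigPoly]
  refine ⟨Submodule.neg_mem _ h.mem, h.nonneg, fun k => ?_, ?_⟩
  · rw [this, norm_neg]; exact h.norm_le k
  · simp only [this, norm_neg]; exact h.sum_le

section GoodNoise

variable {n S s : ℕ} {L u : ℝ} {X : Submodule ℂ (ℤ → ℂ)}
  {z : EuclideanSpace ℂ (noiseWindow n)} {c : ℝ} {φ : ℤ → ℂ}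

/-- The pairing of a fixed vector with the filtered noise, as a functional of the filter. -/
noncomputable def filterFunctional (n : ℕ) (z : EuclideanSpace ℂ (noiseWindow n))
    (w : EuclideanSpace ℂ (Finset.Icc (-(n : ℤ)) n)) : (ℤ → ℂ) →ₗ[ℝ] ℝ :=
  (innerSL ℝ w).toLinearMap ∘ₗ
    ((convWindow n).flip (extendZero (noiseWindow n) z)).restrictScalars ℝ

lemma filterFunctional_apply (n : ℕ) (z : EuclideanSpace ℂ (noiseWindow n))
    (w : EuclideanSpace ℂ (Finset.Icc (-(n : ℤ)) n)) (φ : ℤ → ℂ) :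
    filterFunctional n z w φ = inner ℝ w (filteredNoise n φ z) := rfl

/-- The norm is linearized by pairing with the vector w itself, held fixed. Sign filters then
dominate, the real and imaginary parts each costing c‖w‖√B, and one factor ‖w‖ cancels. -/
lemma GoodNoise.norm_sq_le (hz : GoodNoise n S s L u X z) (hφ : HasSparseSpectrum n S c φ) :
    ‖filteredNoise n φ z‖ ^ 2 ≤ 4 * c ^ 2 * (3 * S + 4 * L ^ 2 * u) := by
  set w := filteredNoise n φ z with hw
  set B := 3 * (S : ℝ) + 4 * L ^ 2 * u
  obtain ⟨b, hb, b', hb', h⟩ := hφ.exists_signFilter (filterFunctional n z w)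
  simp only [filterFunctional_apply, ← hw, real_inner_self_eq_norm_sq] at h
  have hB : 0 ≤ B := (sq_nonneg _).trans (hz.norm_sq_lt b hb).le
  have h1 : ∀ b ∈ signPatterns (2 * n + 1) S, ‖filteredNoise n (signFilter n b) z‖ ≤ √B :=
    fun b hb => Real.le_sqrt_of_sq_le (hz.norm_sq_lt b hb).le
  have hI : filteredNoise n (Complex.I • signFilter n b') z =
      Complex.I • filteredNoise n (signFilter n b') z := by
    simp [filteredNoise_eq]
  have h2 : inner ℝ w (filteredNoise n (signFilter n b) z) ≤ ‖w‖ * √B :=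
    (real_inner_le_norm _ _).trans (mul_le_mul_of_nonneg_left (h1 b hb) (norm_nonneg _))
  have h3 : inner ℝ w (filteredNoise n (Complex.I • signFilter n b') z) ≤ ‖w‖ * √B := by
    refine (real_inner_le_norm _ _).trans (mul_le_mul_of_nonneg_left ?_ (norm_nonneg _))
    rw [hI, norm_smul, Complex.norm_I, one_mul]
    exact h1 b' hb'
  have hc := hφ.nonneg
  have h4 : ‖w‖ ^ 2 ≤ ‖w‖ * (2 * c * √B) := by
    have := mul_le_mul_of_nonneg_left h2 hc
    have := mul_le_mul_of_nonneg_left h3 hc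
    linarith
  have h5 : ‖w‖ ≤ 2 * c * √B := by
    rcases (norm_nonneg w).eq_or_lt with h0 | h0
    · rw [← h0]; positivity
    · rw [sq] at h4
      exact le_of_mul_le_mul_left h4 h0
  calc ‖w‖ ^ 2 ≤ (2 * c * √B) ^ 2 := pow_le_pow_left₀ (norm_nonneg _) h5 2
    _ = 4 * c ^ 2 * B := by rw [mul_pow, Real.sq_sqrt hB]; ring

lemma GoodNoise.inner_le (hz : GoodNoise n S s L u X z) (hφ : HasSparseSpectrum n S c φ) :
    inner ℝ (innerNoise n z) (filteredNoise n φ z) ≤ 2 * c * (3 * S + 4 * L * u) := by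
  obtain ⟨b, hb, b', hb', h⟩ := hφ.exists_signFilter (filterFunctional n z (innerNoise n z))
  simp only [filterFunctional_apply] at h
  have h1 := mul_le_mul_of_nonneg_left (hz.inner_lt b hb).le hφ.nonneg
  have h2 := mul_le_mul_of_nonneg_left (hz.inner_I_lt b' hb').le hφ.nonneg
  linarith

lemma GoodNoise.neg_inner_le (hz : GoodNoise n S s L u X z) (hφ : HasSparseSpectrum n S c φ) :
    -inner ℝ (innerNoise n z) (filteredNoise n φ z) ≤ 2 * c * (3 * S + 4 * L * u) := by
  have := hz.inner_le hφ.neg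
  have h : filteredNoise n (-φ) z = -filteredNoise n φ z := by simp [filteredNoise_eq]
  rwa [h, inner_neg_right] at this

/-- Only the projection of the noise on the window of X is seen by v, so the bound holds for every v
in X, even one chosen from the noise. -/
lemma GoodNoise.inner_mem_le (hz : GoodNoise n S s L u X z) {v : ℤ → ℂ} (hv : v ∈ X) :
    inner ℝ (innerNoise n z) (restrictWindow n v) ≤
      √(3 * s + 4 * u) * ‖restrictWindow n v‖ := by
  have hmem : restrictWindow n v ∈ windowSubmodule n X := Submodule.mem_map_of_mem hv
  have h := (windowSubmodule n X).starProjection_inner_eq_zero (innerNoise n z) _ hmem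
  rw [inner_sub_left, sub_eq_zero] at h
  rw [h]
  exact (real_inner_le_norm _ _).trans (mul_le_mul_of_nonneg_right
    (Real.le_sqrt_of_sq_le hz.proj_lt.le) (norm_nonneg _))

end GoodNoise

/-! ### Deterministic error bound -/

lemma IsShiftInvariant.conv_mem {X : Submodule ℂ (ℤ → ℂ)} (hX : IsShiftInvariant X)
    [Module.Finite ℂ X] {n : ℕ} {φ x : ℤ → ℂ} (hφ : φ ∈ bandLimited n) (hx : x ∈ X) :
    conv φ x ∈ X := by
  have : conv φ x = ∑ τ ∈ Finset.Icc (-(n : ℤ)) n, φ τ • fun t => x (t + -τ) := by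
    ext t
    rw [conv_eq_sum hφ]
    simp [sub_eq_add_neg]
  rw [this]
  exact Submodule.sum_mem _ fun τ _ => X.smul_mem _ (hX.shift_mem hx _)

/-- The error of a filter whose residual is at most that of a reproducing filter, on the event
that the noise obeys the bounds. -/
lemma GoodNoise.error_le {n S s : ℕ} {L u c σ : ℝ} {X : Submodule ℂ (ℤ → ℂ)}
    [Module.Finite ℂ X] (hX : IsShiftInvariant X)
    {z : EuclideanSpace ℂ (noiseWindow n)} (hz : GoodNoise n S s L u X z) (hu : 0 ≤ u)
    (hc : 1 ≤ c) (hσ : 0 ≤ σ) {x y φ φ₀ : ℤ → ℂ} (hx : x ∈ X)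
    (hy : ∀ t ∈ noiseWindow n, y t = x t + σ * extendZero (noiseWindow n) z t)
    (hφ₀ : HasSparseSpectrum n S 1 φ₀) (hrep : conv φ₀ x = x) (hφ : HasSparseSpectrum n S c φ)
    (hle : windowNorm n (conv φ y - y) ^ 2 ≤ windowNorm n (conv φ₀ y - y) ^ 2) :
    windowNorm n (conv φ y - x) ^ 2 ≤ σ ^ 2 * ((8 + 4 * c) * (3 * S + 4 * L ^ 2 * u) +
      (8 + 8 * c) * (3 * S + 4 * L * u) + (4 + 4 * c) * (3 * s + 4 * u)) := by
  set ζ := extendZero (noiseWindow n) z with hζ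
  set W := restrictWindow n
  set e := innerNoise n z with he
  set w := filteredNoise n φ z with hw
  set w₀ := filteredNoise n φ₀ z with hw₀
  set a := W (conv φ y - x) with ha
  have hconv : ∀ ψ ∈ bandLimited n, W (conv ψ y) = W (conv ψ x) + σ • filteredNoise n ψ z := by
    intro ψ hψ
    have h1 : convWindow n ψ y = convWindow n ψ (x + (σ : ℂ) • ζ) :=
      convWindow_congr ψ fun t ht => by rw [hy t ht]; rfl
    rw [restrictWindow_conv hψ, restrictWindow_conv hψ, h1, map_add, map_smul, filteredNoise_eq]
    rfl
  have hWy : W y = W x + σ • e := by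
    ext t
    rw [restrictWindow_apply, hy t (window_subset_noiseWindow n t.2)]
    rfl
  have h1 : W (conv φ y - y) = a - σ • e := by
    rw [ha, map_sub, map_sub, hWy]; abel
  have h2 : W (conv φ₀ y - y) = σ • w₀ - σ • e := by
    rw [map_sub, hconv _ hφ₀.mem, hrep, hWy]; abel
  rw [windowNorm_eq_norm, windowNorm_eq_norm, h1, h2, norm_sub_sq_real, norm_sub_sq_real,
    inner_smul_right, inner_smul_right, inner_smul_left, norm_smul σ w₀, Real.norm_eq_abs,
    mul_pow, sq_abs, conj_trivial, real_inner_comm e a, real_inner_comm e w₀] at hle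
  rw [windowNorm_eq_norm]
  change ‖a‖ ^ 2 ≤ _
  set v := conv φ x - x with hv
  have hvX : v ∈ X := X.sub_mem (hX.conv_mem hφ.mem hx) hx
  have hav : a = W v + σ • w := by
    rw [ha, map_sub, hconv _ hφ.mem, hv, map_sub]; abel
  set B₁ := 3 * (S : ℝ) + 4 * L ^ 2 * u
  set B₂ := 3 * (S : ℝ) + 4 * L * u
  set B₃ := 3 * (s : ℝ) + 4 * u
  have hB₃ : 0 ≤ B₃ := by positivity
  set q := √B₃ with hq
  have hq0 : 0 ≤ q := Real.sqrt_nonneg _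
  have hqsq : q ^ 2 = B₃ := Real.sq_sqrt hB₃
  have hWv : ‖W v‖ ≤ ‖a‖ + σ * ‖w‖ := by
    have : W v = a - σ • w := by rw [hav]; abel
    rw [this]
    refine (norm_sub_le _ _).trans_eq ?_
    rw [norm_smul, Real.norm_of_nonneg hσ]
  have hproj : inner ℝ e (W v) ≤ q * (‖a‖ + σ * ‖w‖) :=
    (hz.inner_mem_le hvX).trans (mul_le_mul_of_nonneg_left hWv hq0)
  have hinner : inner ℝ e a ≤ q * (‖a‖ + σ * ‖w‖) + σ * (2 * c * B₂) := by
    rw [hav, inner_add_right, inner_smul_right, ← hav]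
    exact add_le_add hproj (mul_le_mul_of_nonneg_left (hz.inner_le hφ) hσ)
  have hG : ‖w‖ ^ 2 ≤ 4 * c ^ 2 * B₁ := hz.norm_sq_le hφ
  have hG₀ : ‖w₀‖ ^ 2 ≤ 4 * 1 ^ 2 * B₁ := hz.norm_sq_le hφ₀
  have hK₀ : -inner ℝ e w₀ ≤ 2 * 1 * B₂ := hz.neg_inner_le hφ₀
  have hc0 : 0 < c := by linarith
  -- Since ‖w‖ is of order c√B₁, weighting the arithmetic-geometric inequality by c keeps the bound
  -- linear in c.
  have hcross : 4 * (q * ‖w‖) ≤ 4 * c * B₃ + 4 * c * B₁ := by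
    have h3 : ‖w‖ ^ 2 / c ≤ 4 * c * B₁ := by
      rw [div_le_iff₀ hc0]
      exact hG.trans_eq (by ring)
    have h4 : 4 * (q * ‖w‖) ≤ 4 * c * q ^ 2 + ‖w‖ ^ 2 / c := by
      have : 0 ≤ (2 * c * q - ‖w‖) ^ 2 / c := by positivity
      have h5 : (2 * c * q - ‖w‖) ^ 2 / c = 4 * c * q ^ 2 + ‖w‖ ^ 2 / c - 4 * (q * ‖w‖) := by
        field_simp
        ring
      linarith
    rw [hqsq] at h4
    linarith
  -- Absorbs the linear term: 2σq‖a‖ ≤ ‖a‖²/2 + 2σ²q².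
  have hsq : 0 ≤ (‖a‖ - 2 * (σ * q)) ^ 2 := sq_nonneg _
  have h5 : ‖a‖ ^ 2 ≤ 2 * σ * (q * (‖a‖ + σ * ‖w‖) + σ * (2 * c * B₂)) +
      σ ^ 2 * (4 * B₁) + 2 * σ ^ 2 * (2 * B₂) := by
    have h6 := mul_le_mul_of_nonneg_left hinner (by positivity : 0 ≤ 2 * σ)
    have h7 := mul_le_mul_of_nonneg_left hG₀ (sq_nonneg σ)
    have h8 := mul_le_mul_of_nonneg_left hK₀ (by positivity : 0 ≤ 2 * σ ^ 2)
    nlinarith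
  have h6 := mul_le_mul_of_nonneg_left hcross (sq_nonneg σ)
  rw [← hqsq] at h6 ⊢
  nlinarith

/-! ### Numerical constants and conclusion -/

lemma twenty_seven_le_cStar : 27 ≤ cStar := by
  unfold cStar
  nlinarith [Real.pi_gt_d2]

/-- The error bound of `GoodNoise.error_le` in closed form. -/
lemma error_bound_le {s N : ℝ} (hs : 1 ≤ s) (hN : 1 ≤ N) {L u ℓ lδ c : ℝ} (hlδ : 0 ≤ lδ)
    (hL : 1 ≤ L) (hLℓ : L ≤ 2 * ℓ) (hu0 : 0 ≤ u)
    (hu : u ≤ 6 * (3 * s * Real.log N + 10 * s + lδ)) (hc : 27 ≤ c) :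
    (8 + 4 * c) * (3 * (18 * s) + 4 * L ^ 2 * u) + (8 + 8 * c) * (3 * (18 * s) + 4 * L * u) +
      (4 + 4 * c) * (3 * s + 4 * u) ≤
      80 * c ^ 2 * (3 * s * Real.log N + 10 * s + lδ) * ℓ ^ 2 := by
  have hlog : 0 ≤ s * Real.log N := mul_nonneg (by linarith) (Real.log_nonneg hN)
  set R := 3 * s * Real.log N + 10 * s + lδ with hR
  have hsR : s ≤ R / 10 := by linarith
  have hR0 : 0 ≤ R := by linarith
  have hL2 : L ≤ L ^ 2 := by nlinarith
  have hLu : L * u ≤ L ^ 2 * u := mul_le_mul_of_nonneg_right hL2 hu0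
  have hu1 : u ≤ L ^ 2 * u := by nlinarith
  have hLR : L ^ 2 * u ≤ 6 * (L ^ 2 * R) := by
    have := mul_le_mul_of_nonneg_left hu (sq_nonneg L)
    linarith
  have hRL : R ≤ L ^ 2 * R := by nlinarith
  set M := L ^ 2 * R
  have hM0 : 0 ≤ M := hR0.trans hRL
  -- Here 54s ≤ 5.4R ≤ 5.4M because R ≥ 10s, and 4L²u ≤ 24M.
  have hB₁ : 3 * (18 * s) + 4 * L ^ 2 * u ≤ 30 * M := by linarith
  have hB₂ : 3 * (18 * s) + 4 * L * u ≤ 30 * M := by linarith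
  have hB₃ : 3 * s + 4 * u ≤ 25 * M := by linarith
  have hLℓ2 : L ^ 2 ≤ 4 * ℓ ^ 2 := by nlinarith
  have hMℓ : M ≤ 4 * (R * ℓ ^ 2) := by
    have := mul_le_mul_of_nonneg_right hLℓ2 hR0
    linarith
  have h1 := mul_le_mul_of_nonneg_left hB₁ (by linarith : 0 ≤ 8 + 4 * c)
  have h2 := mul_le_mul_of_nonneg_left hB₂ (by linarith : 0 ≤ 8 + 8 * c)
  have h3 := mul_le_mul_of_nonneg_left hB₃ (by linarith : 0 ≤ 4 + 4 * c)
  have h4 : (8 + 4 * c) * (30 * M) + (8 + 8 * c) * (30 * M) + (4 + 4 * c) * (25 * M) ≤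
      20 * c ^ 2 * M := by
    -- This reads 580 + 460c ≤ 20c², true from about c = 24.2 on, hence for c ≥ 27.
    have : (8 + 4 * c) * 30 + (8 + 8 * c) * 30 + (4 + 4 * c) * 25 ≤ 20 * c ^ 2 := by nlinarith
    have := mul_le_mul_of_nonneg_right this hM0
    linarith
  have h5 : 20 * c ^ 2 * M ≤ 20 * c ^ 2 * (4 * (R * ℓ ^ 2)) :=
    mul_le_mul_of_nonneg_left hMℓ (by positivity)
  linarith

lemma spectralBound_le_two_mul_log {s : ℕ} (hs : 1 ≤ s) :
    4 + 2 * Real.log ((18 * s : ℕ) : ℝ) ≤ 2 * Real.log (9 * Real.exp 4 * s) := by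
  have hs' : (0 : ℝ) < s := by exact_mod_cast hs
  have h1 : Real.log (9 * Real.exp 4 * s) = Real.log 9 + 4 + Real.log s := by
    rw [Real.log_mul (by positivity) hs'.ne', Real.log_mul (by norm_num) (Real.exp_pos _).ne',
      Real.log_exp]
  have h2 : Real.log ((18 * s : ℕ) : ℝ) = Real.log 2 + Real.log 9 + Real.log s := by
    push_cast
    rw [Real.log_mul (by norm_num : (18 : ℝ) ≠ 0) hs'.ne', show (18 : ℝ) = 2 * 9 by norm_num,
      Real.log_mul two_ne_zero (by norm_num)]
  rw [h1, h2]
  have := Real.log_two_lt_d9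
  linarith

lemma log_union_bound_le {s : ℕ} (hs : 1 ≤ s) (n : ℕ) {δ : ℝ} (hδ : 0 < δ) (h : δ ≤ 1) :
    Real.log (4 * (3 * (2 * n + 1)) ^ (18 * s) / δ) ≤
      6 * (3 * s * Real.log (2 * n + 1) + 10 * s + Real.log δ⁻¹) := by
  have hs' : (1 : ℝ) ≤ s := by exact_mod_cast hs
  have hN : (0 : ℝ) < 2 * n + 1 := by positivity
  have h0 : 0 ≤ Real.log δ⁻¹ := Real.log_nonneg ((one_le_inv₀ hδ).2 h)
  rw [div_eq_mul_inv, Real.log_mul (by positivity) (by positivity),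
    Real.log_mul (by norm_num) (by positivity), Real.log_pow,
    Real.log_mul (by norm_num) hN.ne']
  have h3 : Real.log 3 ≤ 2 := by
    have := Real.log_le_sub_one_of_pos (show (0 : ℝ) < 3 by norm_num)
    linarith
  have h4 : Real.log 4 ≤ 3 := by
    have := Real.log_le_sub_one_of_pos (show (0 : ℝ) < 4 by norm_num)
    linarith
  have h5 : (s : ℝ) * Real.log 3 ≤ s * 2 := mul_le_mul_of_nonneg_left h3 (by linarith)
  push_cast
  nlinarith

theorem theorem3p1 (s m n : ℕ) (hs : 1 ≤ s) (hm : s ≤ m + 1) (hn : n = 9 * m)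
    -- the signal lies in a shift-invariant subspace of dimension at most `s`
    (X : Submodule ℂ (ℤ → ℂ)) (hX : IsShiftInvariant X)
    (hfin : Module.Finite ℂ X) (hdim : Module.finrank ℂ X ≤ s)
    (x : ℤ → ℂ) (hx : x ∈ X)
    {Ω : Type*} [MeasurableSpace Ω] (P : Measure Ω) [IsProbabilityMeasure P]
    -- i.i.d. standard complex Gaussian noise on the observation window `{-2n, ..., 2n}`
    (ξ : ℤ → Ω → ℂ)
    (hlaw : ∀ t : Finset.Icc (-(2 * n : ℤ)) (2 * n), HasLaw (ξ t) stdComplexGaussian P)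
    (hindep : iIndepFun (fun t : Finset.Icc (-(2 * n : ℤ)) (2 * n) => ξ t) P)
    -- the observations (values outside the window are irrelevant)
    (σ : ℝ) (hσ : 0 ≤ σ) (y : Ω → ℤ → ℂ)
    (hy : ∀ ω, ∀ t ∈ Finset.Icc (-(2 * n : ℤ)) (2 * n), y ω t = x t + σ * ξ t ω) :
    (∀ v : ℤ → ℂ, ∃ φ, IsOptimalFilter s n v φ) ∧
    ∀ φhat : Ω → ℤ → ℂ, (∀ᵐ ω ∂P, IsOptimalFilter s n (y ω) (φhat ω)) →
      ∀ δ : ℝ, 0 < δ → δ < 1 →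
        -- the event on which the bound fails has (outer) probability at most `δ`
        P {ω | ¬ (windowNorm n (conv (φhat ω) (y ω) - x) ^ 2 ≤
            80 * cStar ^ 2 * σ ^ 2 *
              (3 * s * Real.log (2 * n + 1) + 10 * s + Real.log δ⁻¹) *
              Real.log (9 * Real.exp 4 * s) ^ 2)} ≤ ENNReal.ofReal δ := by
  refine ⟨exists_isOptimalFilter hs n, fun φhat hopt δ hδ hδ1 => ?_⟩
  obtain ⟨φ₀, hφ₀, hrep⟩ := exists_reproducing_filter hn hX hdim
  have hS : 1 ≤ 18 * s := by omega
  have hs' : (1 : ℝ) ≤ s := by exact_mod_cast hs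
  set L := 4 + 2 * Real.log ((18 * s : ℕ) : ℝ) with hLdef
  have hL : 1 ≤ L := by
    have := Real.log_nonneg (by exact_mod_cast hS : (1 : ℝ) ≤ ((18 * s : ℕ) : ℝ))
    linarith
  have hcount : (1 : ℝ) ≤ 4 * (3 * (2 * n + 1)) ^ (18 * s) := by
    have : (1 : ℝ) ≤ (3 * (2 * n + 1)) ^ (18 * s) :=
      one_le_pow₀ (by have : (0 : ℝ) ≤ n := Nat.cast_nonneg n; linarith)
    linarith
  -- Chosen so that the union bound over the sign patterns equals exactly δ.
  set u := Real.log (4 * (3 * (2 * n + 1)) ^ (18 * s) / δ) with hudef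
  have hu0 : 0 ≤ u := Real.log_nonneg ((one_le_div hδ).2 (by linarith))
  have hu := log_union_bound_le hs n hδ hδ1.le
  have hlδ : 0 ≤ Real.log δ⁻¹ := Real.log_nonneg ((one_le_inv₀ hδ).2 hδ1.le)
  let Z : Ω → EuclideanSpace ℂ (noiseWindow n) := fun ω => WithLp.toLp 2 fun t => ξ t ω
  have hZ : AEMeasurable Z P := by
    have := fun t => (hlaw t).aemeasurable
    fun_prop
  have hmap : P.map Z = stdGaussian (EuclideanSpace ℂ (noiseWindow n)) :=
    map_eq_stdGaussian hlaw hindep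
  have hgood : ∀ ω, IsOptimalFilter s n (y ω) (φhat ω) → GoodNoise n (18 * s) s L u X (Z ω) →
      windowNorm n (conv (φhat ω) (y ω) - x) ^ 2 ≤ 80 * cStar ^ 2 * σ ^ 2 *
        (3 * s * Real.log (2 * n + 1) + 10 * s + Real.log δ⁻¹) *
        Real.log (9 * Real.exp 4 * s) ^ 2 := by
    rintro ω ⟨hfeas, hmin⟩ hgood
    have h := hgood.error_le hX hu0 (by linarith [twenty_seven_le_cStar] : 1 ≤ cStar) hσ hx
      (y := y ω) (fun t ht => by rw [hy ω t ht, extendZero_of_mem _ ht]) hφ₀ (hrep x hx)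
      (hasSparseSpectrum_of_feasible hs hfeas)
      (isMinOn_iff.1 hmin φ₀ (feasible_of_hasSparseSpectrum_one hs hφ₀))
    have hb := error_bound_le hs' (by have : (0 : ℝ) ≤ n := Nat.cast_nonneg n; linarith :
      (1 : ℝ) ≤ 2 * n + 1) hlδ hL (spectralBound_le_two_mul_log hs) hu0 hu twenty_seven_le_cStar
    push_cast at h
    refine h.trans ((mul_le_mul_of_nonneg_left hb (sq_nonneg σ)).trans_eq ?_)
    ring
  calc _ ≤ P ({ω | ¬ IsOptimalFilter s n (y ω) (φhat ω)} ∪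
        Z ⁻¹' {z | ¬ GoodNoise n (18 * s) s L u X z}) := by
        refine measure_mono fun ω hω => ?_
        by_contra hcon
        rw [Set.mem_union, not_or] at hcon
        exact hω (hgood ω (not_not.1 hcon.1) (not_not.1 hcon.2))
    -- A preimage has at most the measure of the set under the image law, measurable or not. Since
    -- the good event does not involve φhat, no measurability of φhat is needed.
    _ ≤ 0 + P.map Z {z | ¬ GoodNoise n (18 * s) s L u X z} :=
        (measure_union_le _ _).trans (add_le_add (ae_iff.1 hopt).le (Measure.le_map_apply hZ _))
    _ ≤ ENNReal.ofReal δ := by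
        rw [zero_add, hmap]
        refine (stdGaussian_not_goodNoise_le hS X hdim u).trans (ENNReal.ofReal_le_ofReal ?_)
        rw [Real.exp_neg, hudef, Real.exp_log (by positivity)]
        have : (4 * (3 * (2 * n + 1)) ^ (18 * s) : ℝ) ≠ 0 := by positivity
        exact le_of_eq (by field_simp)
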